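/- Let $\mathbb K$ be a field. Let $Q=(Q_0,Q_1,s,t)$ be a quiver with finitely many vertices and arrows, graded by a function $|\cdot|:Q_1\to\mathbb Z$ (extended additively to paths); paths are written from right to left. Let $R$ be a set of paths in $Q$ and let $\mathrm{Sp}$ be a set of loops of $Q$, all of degree $0$. Put $S=R\cup\{\varepsilon^2\mid\varepsilon\in\mathrm{Sp}\}$ and assume that $(Q,R,\mathrm{Sp})$ is a graded skew-gentle triple, i.e. that $(Q,S)$ is a gentle pair: every element of $S$ is a path of length $2$; every vertex is the source of at most two arrows and the target of at most two arrows; and for every arrow $\alpha$ there is at most one arrow $\beta$ with $t(\beta)=s(\alpha)$ and $\alpha\beta\in S$, at most one such $\beta$ with $\alpha\beta\notin S$, at most one arrow $\gamma$ with $s(\gamma)=t(\alpha)$ and $\gamma\alpha\in S$, and at most one such $\gamma$ with $\gamma\alpha\notin S$. Let \[A=\mathbb KQ/\langle R\cup\{\varepsilon^2-\varepsilon\mid\varepsilon\in\mathrm{Sp}\}\rangle\] be the corresponding graded skew-gentle algebra, with the $\mathbb Z$-grading induced by the degrees of paths. For $n\ge 0$ let $\Gamma_n$ be the set of paths of length $n$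 in $Q$ all of whose subpaths of length $2$ lie in $S$ (so $\Gamma_0=Q_0$ and $\Gamma_1=Q_1$), and for $n\ge 1$ let $\mathrm{Sp}^n=\{\varepsilon^n\mid\varepsilon\in\mathrm{Sp}\}\subseteq\Gamma_n$; for $\varepsilon\in\mathrm{Sp}$, $\varepsilon^0$ denotes the trivial path at $s(\varepsilon)$. Write $\otimes=\otimes_{\mathbb KQ_0}$, and grade the $A$-bimodule $A\otimes\mathbb K\Gamma_n\otimes A$ by $|a\otimes q\otimes b|=|a|+|q|+|b|$. Then $A$ is a $\mathbb Z$-graded algebra, there are well-defined $A$-bimodule morphisms $d_n:A\otimes\mathbb K\Gamma_n\otimes A\to A\otimes\mathbb K\Gamma_{n-1}\otimes A$ ($n\ge 1$) and $d_0:A\otimes\mathbb K\Gamma_0\otimes A\to A$ with $d_0(1\otimes e\otimes 1)=e$ for $e\in\Gamma_0$ and, for $n\ge1$, \[d_n(1\otimes q\otimes 1)=\begin{cases} a_n\otimes a_{n-1}\cdots a_1\otimes 1+(-1)^n\,1\otimes a_n\cdots a_2\otimes a_1 & \text{if } q=a_n\cdots a_1\in\Gamma_n\setminus\mathrm{Sp}^n,\\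 \varepsilon\otimes\varepsilon^{n-1}\otimes 1-1\otimes\varepsilon^{n-1}\otimes\varepsilon & \text{if } q=\varepsilon^n\in\mathrm{Sp}^n,\ n \text{ odd},\\ \varepsilon\otimes\varepsilon^{n-1}\otimes 1+1\otimes\varepsilon^{n-1}\otimes\varepsilon-1\otimes\varepsilon^{n-1}\otimes 1 & \text{if } q=\varepsilon^n\in\mathrm{Sp}^n,\ n \text{ even}, \end{cases}\] and, with these differentials, \[\cdots\to A\otimes\mathbb K\Gamma_n\otimes A\xrightarrow{d_n}A\otimes\mathbb K\Gamma_{n-1}\otimes A\to\cdots\to A\otimes\mathbb K\Gamma_1\otimes A\xrightarrow{d_1}A\otimes\mathbb K\Gamma_0\otimes A\xrightarrow{d_0}A\to0\] is a graded projective resolution of $A$ as a graded $A$-bimodule: the sequence is exact, every $d_n$ is homogeneous of degree $0$, and every $A\otimes\mathbb K\Gamma_n\otimes A$ is a graded bimodule which is projective both as an $A$-bimodule and in the category of graded $A$-bimodules with morphisms of degree $0$. -/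

import Mathlib

universe uK uV uE w

open scoped TensorProduct

namespace SkewGentle

/-- A quiver `(Q₀, Q₁, s, t)` with vertex set `V` and arrow set `E`. -/
structure Quiv (V : Type uV) (E : Type uE) where
  src : E → V
  tgt : E → V

section Paths

variable {V : Type uV} {E : Type uE}

/-- `Q.IsWalk j w i`: the word `w = [a_l, …, a_1]`, written from right to left as a composition
of functions, is a path `a_l ⋯ a_1` from the vertex `i` to the vertex `j`. -/
def Quiv.IsWalk (Q : Quiv V E) : V → List E → V → Prop
  | j, [], i => j = i
  | j, a :: w, i => Q.tgt a = j ∧ Q.IsWalk (Q.src a) w i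

theorem Quiv.IsWalk.append {Q : Quiv V E} {u v : List E} {k j i : V}
    (hu : Q.IsWalk k u j) (hv : Q.IsWalk j v i) : Q.IsWalk k (u ++ v) i := by
  induction u generalizing k with
  | nil => cases hu; exact hv
  | cons a u ih => exact ⟨hu.1, ih hu.2⟩

/-- A path in `Q`; the trivial path at a vertex has the empty word. -/
@[ext]
structure QPath (Q : Quiv V E) where
  tgt : V
  word : List E
  src : V
  isWalk : Q.IsWalk tgt word src

namespace QPath

variable {Q : Quiv V E}

/-- The length of a path. -/
def length (p : QPath Q) : ℕ := p.word.length

/-- The trivial path `e_i`. -/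
def triv (Q : Quiv V E) (i : V) : QPath Q := ⟨i, [], i, rfl⟩

/-- An arrow as a path of length one. -/
def arrow (Q : Quiv V E) (a : E) : QPath Q := ⟨Q.tgt a, [a], Q.src a, rfl, rfl⟩

/-- The composition `p q` (first `q`, then `p`) of composable paths. -/
def comp (p q : QPath Q) (h : p.src = q.tgt) : QPath Q :=
  ⟨p.tgt, p.word ++ q.word, q.src, p.isWalk.append (h ▸ q.isWalk)⟩

/-- The path `αβ` of length two. -/
def two (α β : E) (h : Q.src α = Q.tgt β) : QPath Q := (arrow Q α).comp (arrow Q β) h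

/-- The path obtained from `a_l ⋯ a_1` by deleting the leftmost arrow `a_l`. -/
def dropLeft : QPath Q → QPath Q
  | ⟨j, [], i, h⟩ => ⟨j, [], i, h⟩
  | ⟨_, a :: w, i, h⟩ => ⟨Q.src a, w, i, h.2⟩

theorem _root_.SkewGentle.Quiv.IsWalk.dropLast {a : E} {w : List E} {j i : V}
    (h : Q.IsWalk j (a :: w) i) :
    Q.IsWalk j (a :: w).dropLast (Q.tgt ((a :: w).getLast (by simp))) := by
  induction w generalizing a j with
  | nil => exact h.1.symm
  | cons b w ih =>
    have := ih h.2
    rw [List.dropLast_cons_cons, List.getLast_cons (by simp)]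
    exact ⟨h.1, this⟩

/-- The path obtained from `a_l ⋯ a_1` by deleting the rightmost arrow `a_1`. -/
def dropRight : QPath Q → QPath Q
  | ⟨j, [], i, h⟩ => ⟨j, [], i, h⟩
  | ⟨j, a :: w, _, h⟩ => ⟨j, (a :: w).dropLast, Q.tgt ((a :: w).getLast (by simp)), h.dropLast⟩

theorem dropLeft_word (p : QPath Q) : p.dropLeft.word = p.word.tail := by
  rcases p with ⟨j, _ | ⟨a, w⟩, i, h⟩ <;> rfl

theorem dropRight_word (p : QPath Q) : p.dropRight.word = p.word.dropLast := by
  rcases p with ⟨j, _ | ⟨a, w⟩, i, h⟩ <;> rfl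

theorem isWalk_replicate {a : E} (h : Q.src a = Q.tgt a) (n : ℕ) :
    Q.IsWalk (Q.tgt a) (List.replicate n a) (Q.src a) := by
  induction n with
  | zero => exact h.symm
  | succ n ih => exact ⟨rfl, h.symm ▸ ih⟩

/-- The power `ε^n` of a loop `ε`; `ε^0` is the trivial path at the vertex of `ε`. -/
def loopPow (ε : E) (h : Q.src ε = Q.tgt ε) (n : ℕ) : QPath Q :=
  ⟨Q.tgt ε, List.replicate n ε, Q.src ε, isWalk_replicate h n⟩

/-- The degree of a path, for a grading `deg` on the arrows. -/
def degree (deg : E → ℤ) (p : QPath Q) : ℤ := (p.word.map deg).sum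

end QPath

/-- Gentle pairs `(Q, R)`. -/
structure IsGentlePair (Q : Quiv V E) (R : Set (QPath Q)) : Prop where
  length_two : ∀ p ∈ R, p.length = 2
  out_le_two : ∀ i : V, {a : E | Q.src a = i}.encard ≤ 2
  in_le_two : ∀ i : V, {a : E | Q.tgt a = i}.encard ≤ 2
  rel_right : ∀ (α β β' : E) (h : Q.src α = Q.tgt β) (h' : Q.src α = Q.tgt β'),
    QPath.two α β h ∈ R → QPath.two α β' h' ∈ R → β = β'
  rel_left : ∀ (α γ γ' : E) (h : Q.src γ = Q.tgt α) (h' : Q.src γ' = Q.tgt α),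
    QPath.two γ α h ∈ R → QPath.two γ' α h' ∈ R → γ = γ'
  nonrel_right : ∀ (α β β' : E) (h : Q.src α = Q.tgt β) (h' : Q.src α = Q.tgt β'),
    QPath.two α β h ∉ R → QPath.two α β' h' ∉ R → β = β'
  nonrel_left : ∀ (α γ γ' : E) (h : Q.src γ = Q.tgt α) (h' : Q.src γ' = Q.tgt α),
    QPath.two γ α h ∉ R → QPath.two γ' α h' ∉ R → γ = γ'

/-- The set `Sp^n = {ε^n | ε ∈ Sp}` of `n`-th powers of loops in `Sp`. -/
def spPowers (Q : Quiv V E) (Sp : Set E) (n : ℕ) : Set (QPath Q) :=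
  {p | ∃ ε ∈ Sp, ∃ h : Q.src ε = Q.tgt ε, p = QPath.loopPow ε h n}

end Paths

/-- A graded skew-gentle triple `(Q, R, Sp)`. The special loops have degree `0`, which is
what makes the relations `ε² - ε` homogeneous. -/
structure Triple (V : Type uV) (E : Type uE) where
  Q : Quiv V E
  deg : E → ℤ
  R : Set (QPath Q)
  Sp : Set E
  loop : ∀ ε ∈ Sp, Q.src ε = Q.tgt ε
  gentle : IsGentlePair Q (R ∪ spPowers Q Sp 2)
  deg_special : ∀ ε ∈ Sp, deg ε = 0

noncomputable section

/-! ### The path algebra -/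

section PathAlgebra

variable (K : Type uK) [Field K] {V : Type uV} {E : Type uE}

/-- The path algebra `K Q`: the vector space with basis the paths of `Q`. -/
def PathAlgebra (Q : Quiv V E) : Type (max uK uV uE) := QPath Q →₀ K

namespace PathAlgebra

variable {K} {Q : Quiv V E}

instance : AddCommGroup (PathAlgebra K Q) := inferInstanceAs (AddCommGroup (QPath Q →₀ K))
instance : Module K (PathAlgebra K Q) := inferInstanceAs (Module K (QPath Q →₀ K))

variable (K) in
/-- The basis element of the path algebra given by a path. -/
def ofPath (p : QPath Q) : PathAlgebra K Q := Finsupp.single p 1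

theorem hom_ext {M : Type*} [AddCommGroup M] [Module K M] {f g : PathAlgebra K Q →ₗ[K] M}
    (h : ∀ p, f (ofPath K p) = g (ofPath K p)) : f = g :=
  Finsupp.lhom_ext' fun p => LinearMap.ext_ring (h p)

/-- Extend a function on paths linearly. -/
def extend {M : Type*} [AddCommGroup M] [Module K M] (f : QPath Q → M) :
    PathAlgebra K Q →ₗ[K] M := Finsupp.linearCombination K f

@[simp] theorem extend_ofPath {M : Type*} [AddCommGroup M] [Module K M] (f : QPath Q → M)
    (p : QPath Q) : extend (K := K) f (ofPath K p) = f p :=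
  (Finsupp.linearCombination_single K 1 p).trans (one_smul K _)

open Classical in
/-- The product of two paths: their composition, or `0` if they are not composable. -/
def pathMul (p q : QPath Q) : PathAlgebra K Q :=
  if h : p.src = q.tgt then ofPath K (p.comp q h) else 0

/-- The bilinear multiplication. -/
def mulₗ : PathAlgebra K Q →ₗ[K] PathAlgebra K Q →ₗ[K] PathAlgebra K Q :=
  extend fun p => extend fun q => pathMul p q

instance : Mul (PathAlgebra K Q) := ⟨fun x y => mulₗ x y⟩

theorem mul_def (x y : PathAlgebra K Q) : x * y = mulₗ x y := rfl

theorem ofPath_mul (p q : QPath Q) : ofPath K p * ofPath K q = pathMul p q := by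
  simp [mul_def, mulₗ]

theorem mul_ofPath_assoc (p q r : QPath Q) :
    ofPath K p * ofPath K q * ofPath K r = ofPath K p * (ofPath K q * ofPath K r) := by
  have mz : ∀ x : PathAlgebra K Q, x * 0 = 0 := fun x => map_zero (mulₗ x)
  have zm : ∀ x : PathAlgebra K Q, 0 * x = 0 := fun x => by rw [mul_def]; simp
  simp only [ofPath_mul, pathMul]
  by_cases h₁ : p.src = q.tgt <;> by_cases h₂ : q.src = r.tgt
  · rw [dif_pos h₁, dif_pos h₂, ofPath_mul, ofPath_mul, pathMul, pathMul,
      dif_pos (show (p.comp q h₁).src = r.tgt from h₂),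
      dif_pos (show p.src = (q.comp r h₂).tgt from h₁)]
    congr 1
    exact QPath.ext rfl (List.append_assoc _ _ _) rfl
  · rw [dif_pos h₁, dif_neg h₂, ofPath_mul, pathMul,
      dif_neg (show ¬ (p.comp q h₁).src = r.tgt from h₂), mz]
  · rw [dif_neg h₁, dif_pos h₂, ofPath_mul, pathMul,
      dif_neg (show ¬ p.src = (q.comp r h₂).tgt from h₁), zm]
  · rw [dif_neg h₁, dif_neg h₂, mz, zm]

theorem mul_assoc_aux (x y z : PathAlgebra K Q) : x * y * z = x * (y * z) := by
  have h : mulₗ.compr₂ mulₗ =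
      LinearMap.mk₂ K (fun x y : PathAlgebra K Q => mulₗ (K := K) x ∘ₗ mulₗ y)
        (by intros; ext; simp) (by intros; ext; simp)
        (by intros; ext; simp) (by intros; ext; simp) :=
    hom_ext fun p => hom_ext fun q => hom_ext fun r => mul_ofPath_assoc p q r
  exact congrArg (fun f => f x y z) h

theorem triv_mul (i : V) (p : QPath Q) :
    mulₗ (ofPath K (QPath.triv Q i)) (ofPath K p) =
      open Classical in if i = p.tgt then ofPath K p else 0 := by
  rw [← mul_def, ofPath_mul, pathMul]
  by_cases h : i = p.tgt
  · subst h; simp [QPath.triv, QPath.comp]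
  · rw [dif_neg (show ¬ (QPath.triv Q i).src = p.tgt from h), if_neg h]

theorem mul_triv (i : V) (p : QPath Q) :
    mulₗ (ofPath K p) (ofPath K (QPath.triv Q i)) =
      open Classical in if p.src = i then ofPath K p else 0 := by
  rw [← mul_def, ofPath_mul, pathMul]
  by_cases h : p.src = i
  · subst h; simp [QPath.triv, QPath.comp]
  · rw [dif_neg (show ¬ p.src = (QPath.triv Q i).tgt from h), if_neg h]

variable [Fintype V]

/-- The unit is the sum of the trivial paths. -/
instance : One (PathAlgebra K Q) := ⟨∑ i : V, ofPath K (QPath.triv Q i)⟩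

theorem one_def : (1 : PathAlgebra K Q) = ∑ i : V, ofPath K (QPath.triv Q i) := rfl

theorem one_mul_aux (x : PathAlgebra K Q) : 1 * x = x := by
  have h : mulₗ (1 : PathAlgebra K Q) = LinearMap.id := hom_ext fun p => by
    classical simp [one_def, triv_mul, Finset.sum_ite_eq']
  exact congrArg (fun f => f x) h

theorem mul_one_aux (x : PathAlgebra K Q) : x * 1 = x := by
  have h : mulₗ.flip (1 : PathAlgebra K Q) = LinearMap.id := hom_ext fun p => by
    classical simp [one_def, mul_triv, Finset.sum_ite_eq]
  exact congrArg (fun f => f x) h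

instance : Ring (PathAlgebra K Q) where
  mul_assoc := mul_assoc_aux
  one_mul := one_mul_aux
  mul_one := mul_one_aux
  zero_mul x := by rw [mul_def]; simp
  mul_zero x := map_zero (mulₗ x)
  left_distrib x y z := map_add (mulₗ x) y z
  right_distrib x y z := by simp [mul_def]
  zsmul := fun n x => n • x
  zsmul_zero' := fun x => zero_smul ℤ x
  zsmul_succ' := fun n x => SubNegMonoid.zsmul_succ' n x
  zsmul_neg' := fun n x => SubNegMonoid.zsmul_neg' n x
  neg_add_cancel := neg_add_cancel
  sub_eq_add_neg := sub_eq_add_neg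

instance : Algebra K (PathAlgebra K Q) :=
  Algebra.ofModule (fun r x y => by simp [mul_def]) (fun r x y => by simp [mul_def])

end PathAlgebra
end PathAlgebra

/-! ### The graded skew-gentle algebra -/

namespace Triple

variable (K : Type uK) [Field K] {V : Type uV} {E : Type uE} (T : Triple V E)

/-- `S = R ∪ {ε² | ε ∈ Sp}`. -/
def S : Set (QPath T.Q) := T.R ∪ spPowers T.Q T.Sp 2

/-- `Γ_n`: the paths of length `n` all of whose subpaths of length two are in `S`. -/
def Gamma (n : ℕ) : Type (max uV uE) :=
  {q : QPath T.Q // q.length = n ∧ ∀ p : QPath T.Q, p.length = 2 → p.word <:+: q.word → p ∈ T.S}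

namespace Gamma

variable {T} {n : ℕ}

/-- The underlying path. -/
def path (q : T.Gamma n) : QPath T.Q := q.1

theorem word_ne_nil (q : T.Gamma (n + 1)) : q.path.word ≠ [] := by
  intro h
  have := q.2.1
  simp only [QPath.length] at this
  rw [show q.1.word = [] from h] at this
  simp at this

/-- The leftmost arrow `a_n` of `a_n ⋯ a_1`. -/
def leftArrow (q : T.Gamma (n + 1)) : E := q.path.word.head q.word_ne_nil

/-- The rightmost arrow `a_1` of `a_n ⋯ a_1`. -/
def rightArrow (q : T.Gamma (n + 1)) : E := q.path.word.getLast q.word_ne_nil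

/-- The path `a_{n-1} ⋯ a_1` obtained from `a_n ⋯ a_1`. -/
def dropLeft (q : T.Gamma (n + 1)) : T.Gamma n :=
  ⟨q.path.dropLeft, by
    have := q.2.1
    simp only [QPath.length] at this
    simp [QPath.length, QPath.dropLeft_word, path, this], fun p hp h => by
    rw [QPath.dropLeft_word] at h
    exact q.2.2 p hp (h.trans (List.tail_suffix _).isInfix)⟩

/-- The path `a_n ⋯ a_2` obtained from `a_n ⋯ a_1`. -/
def dropRight (q : T.Gamma (n + 1)) : T.Gamma n :=
  ⟨q.path.dropRight, by
    have := q.2.1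
    simp only [QPath.length] at this
    simp [QPath.length, QPath.dropRight_word, path, this], fun p hp h => by
    rw [QPath.dropRight_word] at h
    exact q.2.2 p hp (h.trans (List.dropLast_prefix _).isInfix)⟩

/-- The power `ε^n ∈ Γ_n` of a special loop `ε`. -/
def spPow {ε : E} (hε : ε ∈ T.Sp) (n : ℕ) : T.Gamma n :=
  ⟨QPath.loopPow ε (T.loop ε hε) n, by simp [QPath.length, QPath.loopPow], by
    rintro ⟨j, w, i, hw⟩ hp h
    refine Or.inr ⟨ε, hε, T.loop ε hε, ?_⟩
    have hw2 : w = List.replicate 2 ε := by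
      refine List.eq_replicate_iff.2 ⟨hp, fun b hb => ?_⟩
      exact List.eq_of_mem_replicate (h.subset hb)
    subst hw2
    exact QPath.ext hw.1.symm rfl (hw.2.2.symm)⟩

end Gamma

variable [Fintype V]

/-- The generators `R ∪ {ε² - ε | ε ∈ Sp}` of the ideal `I`. -/
def relators : Set (PathAlgebra K T.Q) :=
  PathAlgebra.ofPath K '' T.R ∪
    {x | ∃ ε ∈ T.Sp, x = PathAlgebra.ofPath K (QPath.arrow T.Q ε) ^ 2 -
      PathAlgebra.ofPath K (QPath.arrow T.Q ε)}

/-- The two-sided ideal `I` of the path algebra. -/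
def ideal : TwoSidedIdeal (PathAlgebra K T.Q) := TwoSidedIdeal.span (T.relators K)

/-- The graded skew-gentle algebra `A = K Q / I`. -/
def Alg : Type (max uK uV uE) := (T.ideal K).ringCon.Quotient

instance : Ring (T.Alg K) := inferInstanceAs (Ring (T.ideal K).ringCon.Quotient)
instance : Algebra K (T.Alg K) := inferInstanceAs (Algebra K (T.ideal K).ringCon.Quotient)

/-- The canonical projection `π : K Q → A`. -/
def proj : PathAlgebra K T.Q →+* T.Alg K := (T.ideal K).ringCon.mk'

/-- The class in `A` of a path. -/
def ofPath (p : QPath T.Q) : T.Alg K := T.proj K (PathAlgebra.ofPath K p)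

/-- The class in `A` of the trivial path at a vertex. -/
def idem (i : V) : T.Alg K := T.ofPath K (QPath.triv T.Q i)

/-- The class in `A` of an arrow. -/
def arr (a : E) : T.Alg K := T.ofPath K (QPath.arrow T.Q a)

/-- The homogeneous component of degree `k` of `A`, spanned by the paths of degree `k`. -/
def algGrading (k : ℤ) : Submodule K (T.Alg K) :=
  Submodule.span K {x | ∃ p : QPath T.Q, p.degree T.deg = k ∧ x = T.ofPath K p}

/-- The enveloping algebra `A ⊗ Aᵒᵖ`; its modules are the `A`-bimodules on which `K` acts
centrally, with `(a ⊗ b) • m = a m b`. -/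
abbrev Env : Type (max uK uV uE) := T.Alg K ⊗[K] (T.Alg K)ᵐᵒᵖ

/-- `a ⊗ b` as an element of the enveloping algebra. -/
def env (a b : T.Alg K) : T.Env K := a ⊗ₜ[K] MulOpposite.op b

/-- `A` as a bimodule over itself, `(a ⊗ b) • x = a x b`. -/
instance : Module (T.Env K) (T.Alg K) := instModuleTensorProductMop K (T.Alg K)

theorem env_smul (a b x : T.Alg K) : T.env K a b • x = a * x * b := by
  change TensorProduct.Algebra.moduleAux _ _ = _
  simp [env, TensorProduct.Algebra.moduleAux, ← mul_assoc]

/-! ### The bimodules `A ⊗ K Γ_n ⊗ A`, tensor products over the span `K Q₀` of the vertices -/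

/-- The free bimodule `A ⊗_K K Γ_n ⊗_K A`, as the direct sum over `γ ∈ Γ_n` of copies of
`A ⊗_K A`. -/
def FreeBimod (n : ℕ) : Type (max uK uV uE) := T.Gamma n →₀ T.Env K

instance (n : ℕ) : AddCommGroup (T.FreeBimod K n) :=
  inferInstanceAs (AddCommGroup (T.Gamma n →₀ T.Env K))
instance (n : ℕ) : Module (T.Env K) (T.FreeBimod K n) :=
  inferInstanceAs (Module (T.Env K) (T.Gamma n →₀ T.Env K))
instance (n : ℕ) : Module K (T.FreeBimod K n) :=
  inferInstanceAs (Module K (T.Gamma n →₀ T.Env K))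
instance (n : ℕ) : IsScalarTower K (T.Env K) (T.FreeBimod K n) :=
  inferInstanceAs (IsScalarTower K (T.Env K) (T.Gamma n →₀ T.Env K))

/-- The pure tensor `a ⊗ γ ⊗ b` over `K`. -/
def freeTensor {n : ℕ} (a : T.Alg K) (γ : T.Gamma n) (b : T.Alg K) : T.FreeBimod K n :=
  Finsupp.single γ (T.env K a b)

open Classical in
/-- The sub-bimodule generated by `a e_i ⊗ γ ⊗ b - a ⊗ e_i γ ⊗ b` and
`a ⊗ γ ⊗ e_i b - a ⊗ γ e_i ⊗ b`, where `e_i γ` is `γ` if `γ` ends at `i` and `0` otherwise,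
and `γ e_i` is `γ` if `γ` starts at `i` and `0` otherwise. -/
def balance (n : ℕ) : Submodule (T.Env K) (T.FreeBimod K n) :=
  Submodule.span (T.Env K)
    ({x | ∃ (a b : T.Alg K) (γ : T.Gamma n) (i : V),
        x = T.freeTensor K (a * T.idem K i) γ b -
          if γ.path.tgt = i then T.freeTensor K a γ b else 0} ∪
      {x | ∃ (a b : T.Alg K) (γ : T.Gamma n) (i : V),
        x = T.freeTensor K a γ (T.idem K i * b) -
          if γ.path.src = i then T.freeTensor K a γ b else 0})

/-- The bimodule `A ⊗ K Γ_n ⊗ A`, with tensor products over `K Q₀`. -/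
def P (n : ℕ) : Type (max uK uV uE) := T.FreeBimod K n ⧸ T.balance K n

instance (n : ℕ) : AddCommGroup (T.P K n) :=
  inferInstanceAs (AddCommGroup (T.FreeBimod K n ⧸ T.balance K n))
instance (n : ℕ) : Module (T.Env K) (T.P K n) :=
  inferInstanceAs (Module (T.Env K) (T.FreeBimod K n ⧸ T.balance K n))
instance (n : ℕ) : Module K (T.P K n) :=
  inferInstanceAs (Module K (T.FreeBimod K n ⧸ T.balance K n))
instance (n : ℕ) : IsScalarTower K (T.Env K) (T.P K n) :=
  inferInstanceAs (IsScalarTower K (T.Env K) (T.FreeBimod K n ⧸ T.balance K n))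

/-- The quotient map from `A ⊗_K K Γ_n ⊗_K A` to `A ⊗ K Γ_n ⊗ A`. -/
def toP (n : ℕ) : T.FreeBimod K n →ₗ[T.Env K] T.P K n := (T.balance K n).mkQ

/-- The element `a ⊗ γ ⊗ b` of `A ⊗ K Γ_n ⊗ A`. -/
def tensor {n : ℕ} (a : T.Alg K) (γ : T.Gamma n) (b : T.Alg K) : T.P K n :=
  T.toP K n (T.freeTensor K a γ b)

/-- The homogeneous component of degree `k` of `A ⊗ K Γ_n ⊗ A`, where `a ⊗ γ ⊗ b` has degree
`|a| + |γ| + |b|`. -/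
def bimodGrading (n : ℕ) (k : ℤ) : Submodule K (T.P K n) :=
  Submodule.span K {x | ∃ (i j : ℤ) (a b : T.Alg K) (γ : T.Gamma n),
    a ∈ T.algGrading K i ∧ b ∈ T.algGrading K j ∧ i + γ.path.degree T.deg + j = k ∧
      x = T.tensor K a γ b}

/-- The defining formulas of the differentials; `d n` is the map `d_{n+1}` from
`A ⊗ K Γ_{n+1} ⊗ A` to `A ⊗ K Γ_n ⊗ A`, and `d₀` is the augmentation. -/
structure IsDifferential (d₀ : T.P K 0 →ₗ[T.Env K] T.Alg K)
    (d : ∀ n : ℕ, T.P K (n + 1) →ₗ[T.Env K] T.P K n) : Prop where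
  augmentation : ∀ q : T.Gamma 0, d₀ (T.tensor K 1 q 1) = T.ofPath K q.path
  nonspecial : ∀ (n : ℕ) (q : T.Gamma (n + 1)), q.path ∉ spPowers T.Q T.Sp (n + 1) →
    d n (T.tensor K 1 q 1) = T.tensor K (T.arr K q.leftArrow) q.dropLeft 1 +
      (-1 : ℤ) ^ (n + 1) • T.tensor K 1 q.dropRight (T.arr K q.rightArrow)
  special_odd : ∀ (n : ℕ) (ε : E) (hε : ε ∈ T.Sp), Odd (n + 1) →
    d n (T.tensor K 1 (Gamma.spPow hε (n + 1)) 1) =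
      T.tensor K (T.arr K ε) (Gamma.spPow hε n) 1 - T.tensor K 1 (Gamma.spPow hε n) (T.arr K ε)
  special_even : ∀ (n : ℕ) (ε : E) (hε : ε ∈ T.Sp), Even (n + 1) →
    d n (T.tensor K 1 (Gamma.spPow hε (n + 1)) 1) =
      T.tensor K (T.arr K ε) (Gamma.spPow hε n) 1 + T.tensor K 1 (Gamma.spPow hε n) (T.arr K ε) -
        T.tensor K 1 (Gamma.spPow hε n) 1

end Triple

/-! ### Graded bimodules and graded projective resolutions -/

section Graded

variable {K : Type*} [Field K] {A : Type*} [Ring A] [Algebra K A]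

/-- The subspaces `𝒜 i`, `i ∈ ℤ`, make `A` a graded algebra. -/
structure IsGradedAlg (𝒜 : ℤ → Submodule K A) : Prop where
  one_mem : (1 : A) ∈ 𝒜 0
  mul_mem : ∀ (i j : ℤ) (a b : A), a ∈ 𝒜 i → b ∈ 𝒜 j → a * b ∈ 𝒜 (i + j)
  internal : DirectSum.IsInternal 𝒜

/-- The subspaces `ℳ j`, `j ∈ ℤ`, make `M` a graded bimodule over the graded algebra `A`. -/
structure IsGradedBimod (𝒜 : ℤ → Submodule K A) {M : Type*} [AddCommGroup M] [Module K M]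
    [Module (A ⊗[K] Aᵐᵒᵖ) M] (ℳ : ℤ → Submodule K M) : Prop where
  smul_mem : ∀ (i j k : ℤ) (a b : A) (m : M), a ∈ 𝒜 i → m ∈ ℳ j → b ∈ 𝒜 k →
    (a ⊗ₜ[K] MulOpposite.op b : A ⊗[K] Aᵐᵒᵖ) • m ∈ ℳ (i + j + k)
  internal : DirectSum.IsInternal ℳ

/-- The map `f` is homogeneous of degree `0`. -/
def PreservesGrading {M N : Type*} [AddCommGroup M] [Module K M] [AddCommGroup N] [Module K N]
    (ℳ : ℤ → Submodule K M) (𝒩 : ℤ → Submodule K N) (f : M → N) : Prop :=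
  ∀ (k : ℤ) (m : M), m ∈ ℳ k → f m ∈ 𝒩 k

/-- `M` is a graded projective bimodule: it is a graded bimodule, it is projective as a bimodule,
and it is projective in the category of graded bimodules and morphisms of degree `0`. -/
structure IsGradedProjective (𝒜 : ℤ → Submodule K A) {M : Type*} [AddCommGroup M] [Module K M]
    [Module (A ⊗[K] Aᵐᵒᵖ) M] (ℳ : ℤ → Submodule K M) : Prop where
  graded : IsGradedBimod 𝒜 ℳ
  projective : Module.Projective (A ⊗[K] Aᵐᵒᵖ) M
  lifting : ∀ (X Y : Type w) [AddCommGroup X] [AddCommGroup Y] [Module K X] [Module K Y]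
    [Module (A ⊗[K] Aᵐᵒᵖ) X] [Module (A ⊗[K] Aᵐᵒᵖ) Y]
    [IsScalarTower K (A ⊗[K] Aᵐᵒᵖ) X] [IsScalarTower K (A ⊗[K] Aᵐᵒᵖ) Y]
    (𝒳 : ℤ → Submodule K X) (𝒴 : ℤ → Submodule K Y),
    IsGradedBimod 𝒜 𝒳 → IsGradedBimod 𝒜 𝒴 →
    ∀ (g : X →ₗ[A ⊗[K] Aᵐᵒᵖ] Y) (f : M →ₗ[A ⊗[K] Aᵐᵒᵖ] Y),
      PreservesGrading 𝒳 𝒴 g → PreservesGrading ℳ 𝒴 f → Function.Surjective g →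
      ∃ h : M →ₗ[A ⊗[K] Aᵐᵒᵖ] X, PreservesGrading ℳ 𝒳 h ∧ g ∘ₗ h = f

/-- The sequence `⋯ → P 1 → P 0 → N → 0` with maps `d n : P (n + 1) → P n` and `d₀ : P 0 → N`
is a graded projective resolution of the graded bimodule `N`. -/
structure IsGradedProjectiveResolution (𝒜 : ℤ → Submodule K A)
    {N : Type*} [AddCommGroup N] [Module K N] [Module (A ⊗[K] Aᵐᵒᵖ) N] (𝒩 : ℤ → Submodule K N)
    {P : ℕ → Type*} [∀ n, AddCommGroup (P n)] [∀ n, Module K (P n)]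
    [∀ n, Module (A ⊗[K] Aᵐᵒᵖ) (P n)] (𝒢 : ∀ n, ℤ → Submodule K (P n))
    (d₀ : P 0 →ₗ[A ⊗[K] Aᵐᵒᵖ] N) (d : ∀ n, P (n + 1) →ₗ[A ⊗[K] Aᵐᵒᵖ] P n) : Prop where
  target_graded : IsGradedBimod 𝒜 𝒩
  gradedProjective : ∀ n, IsGradedProjective.{w} 𝒜 (𝒢 n)
  augmentation_degree : PreservesGrading (𝒢 0) 𝒩 d₀
  differential_degree : ∀ n, PreservesGrading (𝒢 (n + 1)) (𝒢 n) (d n)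
  surjective : Function.Surjective d₀
  exact_zero : Function.Exact (d 0) d₀
  exact_succ : ∀ n, Function.Exact (d (n + 1)) (d n)

end Graded

end

end SkewGentle

/-!
Rewriting an arrow times a path (to `0` for a relation `ab ∈ R`, to the path itself for a repeated
special loop) makes `A` act on the span of all paths. Hence the paths fixed by this action, the
normal ones, form a basis of `A`, and a left `A`-linear map on `A ⊗ K Γ_n ⊗ A` is determined by its
values on `1 ⊗ γ ⊗ u` with `u` normal.

A contracting homotopy, linear over `A` on the left, sends `1 ⊗ γ ⊗ u` with `γ ∈ Γ_n`, `n ≥ 1`, to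
`(-1)^(n-1) 1 ⊗ γ b ⊗ u'` if `u = b u'` and `γ b ∈ Γ_(n+1)`, and to `0` if `γ` does not extend along
`u`. In degree `0` it is minus the universal derivation of the path `u`. The one exception are the
special loops `ε` with `ε² ∈ R`: then `ε = ε² = 0` in `A`, the differential of `ε^n` reduces to
`-1 ⊗ ε^(n-1) ⊗ 1` for even `n` and to `0` for odd `n`, and the homotopy inverts it directly.
-/

namespace SkewGentle

noncomputable section

section Gradings

variable {ι R M N : Type*} [DecidableEq ι]

theorem isInternal_of_coaction [Ring R] [AddCommGroup M] [Module R M] {ℳ : ι → Submodule R M}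
    (hspan : ⨆ i, ℳ i = ⊤) (δ : M →ₗ[R] ι →₀ M) (hδ : ∀ i, ∀ m ∈ ℳ i, δ m = Finsupp.single i m) :
    DirectSum.IsInternal ℳ := by
  rw [DirectSum.isInternal_submodule_iff_iSupIndep_and_iSup_eq_top, iSupIndep_def]
  refine ⟨fun i => Submodule.disjoint_def.2 fun m hm hm' => ?_, hspan⟩
  have others_le : ⨆ j, ⨆ (_ : j ≠ i), ℳ j ≤ LinearMap.ker (Finsupp.lapply i ∘ₗ δ) :=
    iSup₂_le fun j hj x hx => by simp [hδ j x hx, hj.symm]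
  simpa [hδ i m hm] using others_le hm'

theorem coe_decompose_apply [Semiring R] [AddCommMonoid M] [AddCommMonoid N] [Module R M]
    [Module R N] (ℳ : ι → Submodule R M) (𝒩 : ι → Submodule R N) [DirectSum.Decomposition ℳ]
    [DirectSum.Decomposition 𝒩] {g : M →ₗ[R] N} (hg : ∀ i, ∀ m ∈ ℳ i, g m ∈ 𝒩 i) (i : ι) (m : M) :
    (DirectSum.decompose 𝒩 (g m) i : N) = g (DirectSum.decompose ℳ m i) := by
  induction m using DirectSum.Decomposition.inductionOn ℳ with
  | zero => simp
  | @homogeneous j m =>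
    obtain rfl | hij := eq_or_ne j i
    · rw [DirectSum.decompose_of_mem_same _ (hg j m m.2), DirectSum.decompose_of_mem_same _ m.2]
    · rw [DirectSum.decompose_of_mem_ne _ (hg j m m.2) hij,
        DirectSum.decompose_of_mem_ne _ m.2 hij, map_zero]
  | add m m' ih ih' => simp [DirectSum.decompose_add, ih, ih']

theorem exists_homogeneous_lift [Semiring R] [AddCommMonoid M] [AddCommMonoid N] [Module R M]
    [Module R N] {ℳ : ι → Submodule R M} {𝒩 : ι → Submodule R N} (hℳ : DirectSum.IsInternal ℳ)
    (h𝒩 : DirectSum.IsInternal 𝒩) {g : M →ₗ[R] N} (hg : ∀ i, ∀ m ∈ ℳ i, g m ∈ 𝒩 i)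
    (hsurj : Function.Surjective g) {i : ι} {y : N} (hy : y ∈ 𝒩 i) : ∃ x ∈ ℳ i, g x = y := by
  let := hℳ.chooseDecomposition
  let := h𝒩.chooseDecomposition
  obtain ⟨x, rfl⟩ := hsurj y
  exact ⟨_, (DirectSum.decompose ℳ x i).2,
    by rw [← coe_decompose_apply ℳ 𝒩 hg, DirectSum.decompose_of_mem_same _ hy]⟩

end Gradings

theorem exact_of_contraction {L M N : Type*} [AddZeroClass M] [Zero N] {f : L → M} {g : M → N}
    (hgf : ∀ x, g (f x) = 0) (s : M → L) (r : N → M) (hr : r 0 = 0)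
    (h : ∀ x, f (s x) + r (g x) = x) : Function.Exact f g := fun x =>
  ⟨fun hx => ⟨s x, by simpa [hx, hr] using h x⟩, by rintro ⟨y, rfl⟩; exact hgf y⟩

section Paths

variable {V : Type uV} {E : Type uE} {Q : Quiv V E}

namespace QPath

/-- The composition `a p` of an arrow `a` with a path `p` that ends at the source of `a`. -/
def cons (a : E) (p : QPath Q) (h : Q.src a = p.tgt) : QPath Q :=
  ⟨Q.tgt a, a :: p.word, p.src, rfl, h ▸ p.isWalk⟩

theorem cons_induction {motive : QPath Q → Prop} (triv : ∀ i, motive (triv Q i))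
    (cons : ∀ a p h, motive p → motive (cons a p h)) (p : QPath Q) : motive p := by
  obtain ⟨j, w, i, hw⟩ := p
  induction w generalizing j with
  | nil => cases hw; exact triv _
  | cons a w ih =>
    obtain ⟨rfl, hw⟩ := hw
    exact cons a ⟨_, w, i, hw⟩ rfl (ih _ hw)

theorem eq_triv_of_word_eq_nil {p : QPath Q} (h : p.word = []) : p = triv Q p.tgt := by
  obtain ⟨j, w, i, hw⟩ := p
  cases h
  cases hw
  rfl

theorem exists_eq_cons {p : QPath Q} {a : E} (h : p.word.head? = some a) :
    ∃ (p' : QPath Q) (ha : Q.src a = p'.tgt), p = cons a p' ha := by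
  obtain ⟨j, _ | ⟨b, w⟩, i, hw⟩ := p
  · simp at h
  · obtain rfl : b = a := by simpa using h
    obtain ⟨rfl, hw⟩ := hw
    exact ⟨⟨_, w, i, hw⟩, rfl, rfl⟩

theorem tgt_eq_of_head? {p : QPath Q} {a : E} (h : p.word.head? = some a) : p.tgt = Q.tgt a := by
  obtain ⟨p', ha, rfl⟩ := exists_eq_cons h
  rfl

theorem exists_eq_two {p : QPath Q} (hp : p.length = 2) :
    ∃ (a b : E) (h : Q.src a = Q.tgt b), p = two a b h := by
  obtain ⟨j, w, i, hw⟩ := p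
  obtain ⟨a, b, rfl⟩ := List.length_eq_two.1 hp
  obtain ⟨rfl, h, rfl⟩ := hw
  exact ⟨a, b, h.symm, rfl⟩

end QPath

end Paths

namespace Triple

variable {V : Type uV} {E : Type uE} (T : Triple V E)

/-- `a b` is a path that lies in `S`. -/
def Rel (a b : E) : Prop := ∃ h : T.Q.src a = T.Q.tgt b, QPath.two a b h ∈ T.S

/-- `a b` is a path that lies in `R`. -/
def ZeroRel (a b : E) : Prop := ∃ h : T.Q.src a = T.Q.tgt b, QPath.two a b h ∈ T.R

/-- A degenerate arrow is a special loop `ε` with `ε² ∈ R`. Such loops are not excluded by the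
definition of a triple; they satisfy `ε = ε² = 0` in the algebra. -/
def IsDegenerate (a : E) : Prop := a ∈ T.Sp ∧ T.ZeroRel a a

variable {T} {a b c : E}

theorem ZeroRel.rel (h : T.ZeroRel a b) : T.Rel a b := ⟨h.1, Or.inl h.2⟩

theorem rel_self (ha : a ∈ T.Sp) : T.Rel a a :=
  ⟨T.loop a ha, Or.inr ⟨a, ha, T.loop a ha, rfl⟩⟩

theorem Rel.zeroRel (h : T.Rel a b) (ha : a ∉ T.Sp) : T.ZeroRel a b := by
  obtain ⟨hab, hR | ⟨ε, hε, hloop, heq⟩⟩ := h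
  · exact ⟨hab, hR⟩
  · have hword : [a, b] = [ε, ε] := congrArg QPath.word heq
    simp only [List.cons.injEq] at hword
    exact absurd (hword.1 ▸ hε) ha

theorem Rel.eq_right (h : T.Rel a b) (h' : T.Rel a c) : b = c :=
  T.gentle.rel_right a b c h.1 h'.1 h.2 h'.2

theorem Rel.eq_left (h : T.Rel b a) (h' : T.Rel c a) : b = c :=
  T.gentle.rel_left a b c h.1 h'.1 h.2 h'.2

theorem Rel.eq_of_left_mem (h : T.Rel a b) (ha : a ∈ T.Sp) : b = a :=
  h.eq_right (rel_self ha)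

theorem Rel.eq_of_right_mem (h : T.Rel a b) (hb : b ∈ T.Sp) : a = b :=
  h.eq_left (rel_self hb)

end Triple

section UniversalProperty

variable {V : Type uV} {E : Type uE} {Q : Quiv V E} [Fintype V]

/-- A realization of the quiver `Q` in a semiring `B`: orthogonal idempotents indexed by the
vertices with sum `1`, and for every arrow an element with the matching left and right
idempotents. Realizations of `Q` in an algebra are the homomorphisms from `K Q` to it. -/
structure Quiv.Realization (Q : Quiv V E) (B : Type*) [Semiring B] where
  vertex : V → B
  arrow : E → B
  vertex_mul_of_ne : ∀ i j, i ≠ j → vertex i * vertex j = 0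
  sum_vertex : ∑ i, vertex i = 1
  vertex_mul_arrow : ∀ a, vertex (Q.tgt a) * arrow a = arrow a
  arrow_mul_vertex : ∀ a, arrow a * vertex (Q.src a) = arrow a

namespace Quiv.Realization

variable {B : Type*}

section Semiring

variable [Semiring B] (X : Q.Realization B)

/-- The product in `B` of the arrows of a path. -/
def ofPath (p : QPath Q) : B := (p.word.map X.arrow).prod * X.vertex p.src

theorem ofPath_triv (i : V) : X.ofPath (QPath.triv Q i) = X.vertex i := by
  simp [ofPath, QPath.triv]

theorem ofPath_cons (a : E) (p : QPath Q) (h : Q.src a = p.tgt) :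
    X.ofPath (QPath.cons a p h) = X.arrow a * X.ofPath p := by
  simp [ofPath, QPath.cons, mul_assoc]

theorem ofPath_arrow (a : E) : X.ofPath (QPath.arrow Q a) = X.arrow a := by
  simp [ofPath, QPath.arrow, X.arrow_mul_vertex]

theorem vertex_mul_self (i : V) : X.vertex i * X.vertex i = X.vertex i := by
  classical
  calc X.vertex i * X.vertex i = ∑ j, X.vertex i * X.vertex j :=
        (Fintype.sum_eq_single i fun j hj => X.vertex_mul_of_ne i j hj.symm).symm
    _ = X.vertex i := by rw [← Finset.mul_sum, X.sum_vertex, mul_one]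

theorem vertex_mul_ofPath (p : QPath Q) : X.vertex p.tgt * X.ofPath p = X.ofPath p := by
  induction p using QPath.cons_induction with
  | triv i => rw [ofPath_triv]; exact X.vertex_mul_self i
  | cons a p h => rw [ofPath_cons, ← mul_assoc]; exact congrArg (· * _) (X.vertex_mul_arrow a)

theorem ofPath_comp (p q : QPath Q) (h : p.src = q.tgt) :
    X.ofPath (p.comp q h) = X.ofPath p * X.ofPath q := by
  calc X.ofPath (p.comp q h) = (p.word.map X.arrow).prod * X.ofPath q := by
        simp [ofPath, QPath.comp, mul_assoc]
    _ = X.ofPath p * X.ofPath q := by rw [ofPath.eq_1 X p, mul_assoc, h, vertex_mul_ofPath]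

theorem ofPath_mul_of_ne {p q : QPath Q} (h : p.src ≠ q.tgt) : X.ofPath p * X.ofPath q = 0 := by
  rw [← X.vertex_mul_ofPath q, ofPath, mul_assoc, ← mul_assoc (X.vertex _),
    X.vertex_mul_of_ne _ _ h, zero_mul, mul_zero]

end Semiring

variable (K : Type uK) [Field K] [Ring B] [Algebra K B] (X : Q.Realization B)

/-- The homomorphism from the path algebra given by a realization of the quiver. -/
def lift : PathAlgebra K Q →ₐ[K] B :=
  AlgHom.ofLinearMap (PathAlgebra.extend X.ofPath)
    (by simp only [PathAlgebra.one_def, map_sum, PathAlgebra.extend_ofPath, ofPath_triv,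
      X.sum_vertex])
    (by
      have hmul : (LinearMap.mul K (PathAlgebra K Q)).compr₂ (PathAlgebra.extend X.ofPath) =
          (LinearMap.mul K B).compl₁₂ (PathAlgebra.extend X.ofPath)
            (PathAlgebra.extend X.ofPath) := by
        refine PathAlgebra.hom_ext fun p => PathAlgebra.hom_ext fun q => ?_
        simp only [LinearMap.compr₂_apply, LinearMap.mul_apply', LinearMap.compl₁₂_apply,
          PathAlgebra.extend_ofPath, PathAlgebra.ofPath_mul, PathAlgebra.pathMul]
        split_ifs with h
        · rw [PathAlgebra.extend_ofPath, X.ofPath_comp p q h]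
        · rw [map_zero, X.ofPath_mul_of_ne h]
      exact fun x y => LinearMap.congr_fun₂ hmul x y)

theorem lift_ofPath (p : QPath Q) : X.lift K (PathAlgebra.ofPath K p) = X.ofPath p :=
  PathAlgebra.extend_ofPath _ _

end Quiv.Realization

end UniversalProperty

section Algebra

namespace Triple

variable (K : Type uK) [Field K] {V : Type uV} {E : Type uE} (T : Triple V E) [Fintype V]

/-- The canonical projection `K Q → A` as a homomorphism of `K`-algebras. -/
def projAlgHom : PathAlgebra K T.Q →ₐ[K] T.Alg K := (T.ideal K).ringCon.mkₐ K

variable {K T}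

theorem projAlgHom_surjective : Function.Surjective (T.projAlgHom K) :=
  RingCon.mkₐ_surjective _

theorem projAlgHom_ofPath (p : QPath T.Q) :
    T.projAlgHom K (PathAlgebra.ofPath K p) = T.ofPath K p := rfl

theorem projAlgHom_eq_zero {x : PathAlgebra K T.Q} (hx : x ∈ T.relators K) :
    T.projAlgHom K x = 0 :=
  (RingCon.eq _).2 ((TwoSidedIdeal.mem_iff _ x).1 (TwoSidedIdeal.subset_span hx))

theorem algHom_ext {M : Type*} [AddCommGroup M] [Module K M] {f g : T.Alg K →ₗ[K] M}
    (h : ∀ p, f (T.ofPath K p) = g (T.ofPath K p)) : f = g := by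
  have hproj : f ∘ₗ (T.projAlgHom K).toLinearMap = g ∘ₗ (T.projAlgHom K).toLinearMap :=
    PathAlgebra.hom_ext h
  exact (LinearMap.cancel_right projAlgHom_surjective).1 hproj

theorem span_range_ofPath : Submodule.span K (Set.range (T.ofPath K)) = ⊤ := by
  rw [← Submodule.ker_mkQ (Submodule.span K _), LinearMap.ker_eq_top]
  exact algHom_ext fun p =>
    (Submodule.Quotient.mk_eq_zero _).2 (Submodule.subset_span (Set.mem_range_self p))

theorem ideal_le_ker_lift {B : Type*} [Ring B] [Algebra K B] {X : T.Q.Realization B}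
    (hzero : ∀ a b, T.ZeroRel a b → X.arrow a * X.arrow b = 0)
    (hidem : ∀ ε ∈ T.Sp, X.arrow ε * X.arrow ε = X.arrow ε) :
    T.ideal K ≤ TwoSidedIdeal.ker (X.lift K) := by
  refine TwoSidedIdeal.span_le.2 ?_
  rintro x (⟨p, hp, rfl⟩ | ⟨ε, hε, rfl⟩) <;> refine (TwoSidedIdeal.mem_ker _).2 ?_
  · obtain ⟨a, b, h, rfl⟩ := QPath.exists_eq_two (T.gentle.length_two p (Or.inl hp))
    rw [X.lift_ofPath K, QPath.two, X.ofPath_comp _ _ h, X.ofPath_arrow, X.ofPath_arrow,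
      hzero a b ⟨h, hp⟩]
  · rw [map_sub, map_pow, X.lift_ofPath K, X.ofPath_arrow, sq, hidem ε hε, sub_self]

variable (K) in
/-- The homomorphism from the skew-gentle algebra given by a realization of the quiver that
satisfies the relations. -/
def lift {B : Type*} [Ring B] [Algebra K B] (X : T.Q.Realization B)
    (hzero : ∀ a b, T.ZeroRel a b → X.arrow a * X.arrow b = 0)
    (hidem : ∀ ε ∈ T.Sp, X.arrow ε * X.arrow ε = X.arrow ε) : T.Alg K →ₐ[K] B :=
  (T.ideal K).ringCon.liftₐ (X.lift K) fun x y hxy => by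
    have hker := ideal_le_ker_lift hzero hidem ((TwoSidedIdeal.rel_iff _ x y).1 hxy)
    rw [TwoSidedIdeal.mem_ker, map_sub, sub_eq_zero] at hker
    exact hker

theorem lift_ofPath {B : Type*} [Ring B] [Algebra K B] (X : T.Q.Realization B)
    (hzero : ∀ a b, T.ZeroRel a b → X.arrow a * X.arrow b = 0)
    (hidem : ∀ ε ∈ T.Sp, X.arrow ε * X.arrow ε = X.arrow ε) (p : QPath T.Q) :
    lift K X hzero hidem (T.ofPath K p) = X.ofPath p :=
  X.lift_ofPath K p

theorem ofPath_mul_ofPath (p q : QPath T.Q) (h : p.src = q.tgt) :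
    T.ofPath K p * T.ofPath K q = T.ofPath K (p.comp q h) := by
  simp only [← projAlgHom_ofPath, ← map_mul, PathAlgebra.ofPath_mul, PathAlgebra.pathMul, dif_pos h]

theorem ofPath_mul_of_ne {p q : QPath T.Q} (h : p.src ≠ q.tgt) :
    T.ofPath K p * T.ofPath K q = 0 := by
  rw [← projAlgHom_ofPath, ← projAlgHom_ofPath, ← map_mul, PathAlgebra.ofPath_mul,
    PathAlgebra.pathMul, dif_neg h, map_zero]

theorem arr_mul_ofPath (a : E) (p : QPath T.Q) (h : T.Q.src a = p.tgt) :
    T.arr K a * T.ofPath K p = T.ofPath K (QPath.cons a p h) :=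
  ofPath_mul_ofPath _ _ h

theorem idem_mul_ofPath (i : V) (p : QPath T.Q) :
    T.idem K i * T.ofPath K p = open Classical in if i = p.tgt then T.ofPath K p else 0 := by
  classical
  split_ifs with h
  · obtain rfl := h
    exact ofPath_mul_ofPath (QPath.triv T.Q p.tgt) p rfl
  · exact ofPath_mul_of_ne h

theorem ofPath_mul_idem (i : V) (p : QPath T.Q) :
    T.ofPath K p * T.idem K i = open Classical in if p.src = i then T.ofPath K p else 0 := by
  classical
  split_ifs with h
  · obtain rfl := h
    exact (ofPath_mul_ofPath p (QPath.triv T.Q p.src) rfl).trans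
      (congrArg _ (QPath.ext rfl (List.append_nil _) rfl))
  · exact ofPath_mul_of_ne h

theorem arr_mul_idem (a : E) : T.arr K a * T.idem K (T.Q.src a) = T.arr K a :=
  (ofPath_mul_idem _ _).trans (if_pos rfl)

theorem idem_mul_arr (a : E) : T.idem K (T.Q.tgt a) * T.arr K a = T.arr K a :=
  (idem_mul_ofPath _ _).trans (if_pos rfl)

theorem idem_mul_self (i : V) : T.idem K i * T.idem K i = T.idem K i :=
  (idem_mul_ofPath _ _).trans (if_pos rfl)

theorem idem_mul_of_ne {i j : V} (h : i ≠ j) : T.idem K i * T.idem K j = 0 :=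
  ofPath_mul_of_ne h

theorem sum_idem : ∑ i : V, T.idem K i = 1 :=
  (map_sum (T.projAlgHom K) _ _).symm.trans (map_one _)

theorem arr_mul_arr_of_zeroRel {a b : E} (h : T.ZeroRel a b) : T.arr K a * T.arr K b = 0 := by
  rw [arr, arr, ofPath_mul_ofPath _ _ h.1]
  exact projAlgHom_eq_zero (Or.inl ⟨_, h.2, rfl⟩)

theorem arr_mul_self {ε : E} (hε : ε ∈ T.Sp) : T.arr K ε * T.arr K ε = T.arr K ε := by
  have hsq := projAlgHom_eq_zero (K := K) (T := T) (Or.inr ⟨ε, hε, rfl⟩)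
  rwa [map_sub, map_pow, sub_eq_zero, sq, projAlgHom_ofPath] at hsq

theorem IsDegenerate.arr_eq_zero {ε : E} (hε : T.IsDegenerate ε) : T.arr K ε = 0 := by
  rw [← arr_mul_self hε.1, arr_mul_arr_of_zeroRel hε.2]

end Triple

end Algebra

/-! ### Normal forms -/

section NormalForms

namespace Triple

variable (K : Type uK) [Field K] {V : Type uV} {E : Type uE} (T : Triple V E)

open Classical in
/-- The normal form of the product `a p` of an arrow `a` with a path `p` in normal form. If
`a b ∈ S` for the first letter `b` of `p`, then the product is zero unless `a` is a special loop;
in that case `b = a`, and the product is `p` because `a² = a`. -/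
def reduceCons (a : E) (p : QPath T.Q) : PathAlgebra K T.Q :=
  if h : T.Q.src a = p.tgt then
    if T.IsDegenerate a then 0
    else if ∃ b, p.word.head? = some b ∧ T.Rel a b then
      if a ∈ T.Sp then PathAlgebra.ofPath K p else 0
    else PathAlgebra.ofPath K (QPath.cons a p h)
  else 0

/-- The operator by which an arrow acts on the span of the paths, extending `reduceCons`. -/
def arrowOp (a : E) : Module.End K (PathAlgebra K T.Q) := PathAlgebra.extend (T.reduceCons K a)

variable {K T} {a b : E} {p : QPath T.Q}

theorem arrowOp_ofPath : T.arrowOp K a (PathAlgebra.ofPath K p) = T.reduceCons K a p :=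
  PathAlgebra.extend_ofPath _ _

theorem reduceCons_of_ne (h : T.Q.src a ≠ p.tgt) : T.reduceCons K a p = 0 := dif_neg h

theorem reduceCons_of_isDegenerate (ha : T.IsDegenerate a) : T.reduceCons K a p = 0 := by
  simp [reduceCons, ha]

theorem reduceCons_of_rel_of_notMem (hb : p.word.head? = some b) (hab : T.Rel a b)
    (ha : a ∉ T.Sp) : T.reduceCons K a p = 0 := by
  simp [reduceCons, hb, hab, ha]

theorem reduceCons_of_head_eq_self (ha : a ∈ T.Sp) (hdeg : ¬ T.IsDegenerate a)
    (hp : p.word.head? = some a) : T.reduceCons K a p = PathAlgebra.ofPath K p := by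
  rw [reduceCons, dif_pos ((T.loop a ha).trans (QPath.tgt_eq_of_head? hp).symm), if_neg hdeg,
    if_pos ⟨a, hp, rel_self ha⟩, if_pos ha]

theorem reduceCons_of_not_rel (hdeg : ¬ T.IsDegenerate a) (h : T.Q.src a = p.tgt)
    (hrel : ∀ b, p.word.head? = some b → ¬ T.Rel a b) :
    T.reduceCons K a p = PathAlgebra.ofPath K (QPath.cons a p h) := by
  rw [reduceCons, dif_pos h, if_neg hdeg, if_neg fun ⟨b, hb, hab⟩ => hrel b hb hab]

variable (K a p) in
theorem reduceCons_eq_zero_or :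
    T.reduceCons K a p = 0 ∨
      ∃ q, q.word.head? = some a ∧ T.reduceCons K a p = PathAlgebra.ofPath K q := by
  classical
  rw [reduceCons]
  split_ifs with h hdeg hrel ha
  · exact Or.inl rfl
  · obtain ⟨b, hb, hab⟩ := hrel
    exact Or.inr ⟨p, hab.eq_of_left_mem ha ▸ hb, rfl⟩
  · exact Or.inl rfl
  · exact Or.inr ⟨QPath.cons a p h, rfl, rfl⟩
  · exact Or.inl rfl

theorem arrowOp_mul_arrowOp_of_zeroRel (hab : T.ZeroRel a b) :
    T.arrowOp K a * T.arrowOp K b = 0 :=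
  PathAlgebra.hom_ext fun p => by
    rw [Module.End.mul_apply, arrowOp_ofPath, LinearMap.zero_apply]
    obtain h | ⟨q, hq, h⟩ := reduceCons_eq_zero_or K b p
    · rw [h, map_zero]
    rw [h, arrowOp_ofPath]
    by_cases ha : a ∈ T.Sp
    · obtain rfl := hab.rel.eq_of_left_mem ha
      exact reduceCons_of_isDegenerate ⟨ha, hab⟩
    · exact reduceCons_of_rel_of_notMem hq hab.rel ha

theorem arrowOp_mul_self (ha : a ∈ T.Sp) : T.arrowOp K a * T.arrowOp K a = T.arrowOp K a := by
  by_cases hdeg : T.IsDegenerate a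
  · rw [arrowOp_mul_arrowOp_of_zeroRel hdeg.2]
    exact PathAlgebra.hom_ext fun p => by
      rw [arrowOp_ofPath, reduceCons_of_isDegenerate hdeg, LinearMap.zero_apply]
  refine PathAlgebra.hom_ext fun p => ?_
  rw [Module.End.mul_apply, arrowOp_ofPath]
  obtain h | ⟨q, hq, h⟩ := reduceCons_eq_zero_or K a p
  · rw [h, map_zero]
  · rw [h, arrowOp_ofPath, reduceCons_of_head_eq_self ha hdeg hq]

variable [Fintype V]

variable (K T) in
/-- The vertices act on the span of the paths by left multiplication and the arrows by
reduction. -/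
def reductionRealization : T.Q.Realization (Module.End K (PathAlgebra K T.Q)) where
  vertex i := LinearMap.mulLeft K (PathAlgebra.ofPath K (QPath.triv T.Q i))
  arrow := T.arrowOp K
  vertex_mul_of_ne i j h := by
    rw [Module.End.mul_eq_comp, ← LinearMap.mulLeft_mul, PathAlgebra.ofPath_mul,
      PathAlgebra.pathMul, dif_neg (show ¬ (QPath.triv T.Q i).src = (QPath.triv T.Q j).tgt from h),
      LinearMap.mulLeft_zero_eq_zero]
  sum_vertex := LinearMap.ext fun x => by
    simp only [LinearMap.sum_apply, LinearMap.mulLeft_apply, ← Finset.sum_mul,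
      ← PathAlgebra.one_def, one_mul, Module.End.one_apply]
  vertex_mul_arrow a := PathAlgebra.hom_ext fun p => by
    obtain h | ⟨q, hq, h⟩ := reduceCons_eq_zero_or K a p
    · simp [arrowOp_ofPath, h]
    · simp [arrowOp_ofPath, h, PathAlgebra.mul_def, PathAlgebra.triv_mul,
        QPath.tgt_eq_of_head? hq]
  arrow_mul_vertex a := PathAlgebra.hom_ext fun p => by
    by_cases h : T.Q.src a = p.tgt
    · simp [PathAlgebra.mul_def, PathAlgebra.triv_mul, h]
    · simp [PathAlgebra.mul_def, PathAlgebra.triv_mul, h, arrowOp_ofPath, reduceCons_of_ne h]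

variable (K T) in
/-- The action of `A` on the span of the paths by reduction. -/
def reduction : T.Alg K →ₐ[K] Module.End K (PathAlgebra K T.Q) :=
  lift K (T.reductionRealization K) (fun _ _ => arrowOp_mul_arrowOp_of_zeroRel)
    fun _ => arrowOp_mul_self

theorem reduction_ofPath (p : QPath T.Q) :
    T.reduction K (T.ofPath K p) = (T.reductionRealization K).ofPath p :=
  lift_ofPath _ _ _ p

variable (K T) in
/-- The normal form of an element of `A`: its action on `1` by reduction. -/
def normalForm : T.Alg K →ₗ[K] PathAlgebra K T.Q :=
  LinearMap.applyₗ 1 ∘ₗ (T.reduction K).toLinearMap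

theorem normalForm_arr_mul (a : E) (x : T.Alg K) :
    T.normalForm K (T.arr K a * x) = T.arrowOp K a (T.normalForm K x) := by
  have harr : T.reduction K (T.arr K a) = T.arrowOp K a :=
    (reduction_ofPath _).trans ((T.reductionRealization K).ofPath_arrow a)
  simp only [normalForm, LinearMap.comp_apply, AlgHom.toLinearMap_apply, map_mul, harr,
    LinearMap.applyₗ_apply_apply, Module.End.mul_apply]

theorem normalForm_idem (i : V) :
    T.normalForm K (T.idem K i) = PathAlgebra.ofPath K (QPath.triv T.Q i) := by
  have hidem : T.reduction K (T.idem K i) =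
      LinearMap.mulLeft K (PathAlgebra.ofPath K (QPath.triv T.Q i)) :=
    (reduction_ofPath _).trans ((T.reductionRealization K).ofPath_triv i)
  simp only [normalForm, LinearMap.comp_apply, AlgHom.toLinearMap_apply, hidem,
    LinearMap.applyₗ_apply_apply, LinearMap.mulLeft_apply, mul_one]

theorem projAlgHom_reduceCons (a : E) (p : QPath T.Q) :
    T.projAlgHom K (T.reduceCons K a p) = T.arr K a * T.ofPath K p := by
  classical
  rw [reduceCons]
  split_ifs with h hdeg hrel ha
  · rw [hdeg.arr_eq_zero, zero_mul, map_zero]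
  · obtain ⟨b, hb, hab⟩ := hrel
    obtain rfl := hab.eq_of_left_mem ha
    obtain ⟨p, hp, rfl⟩ := QPath.exists_eq_cons hb
    rw [projAlgHom_ofPath, ← arr_mul_ofPath, ← mul_assoc, arr_mul_self ha]
  · obtain ⟨b, hb, hab⟩ := hrel
    obtain ⟨p, hp, rfl⟩ := QPath.exists_eq_cons hb
    rw [← arr_mul_ofPath, ← mul_assoc, arr_mul_arr_of_zeroRel (hab.zeroRel ha), zero_mul, map_zero]
  · rw [projAlgHom_ofPath, arr_mul_ofPath]
  · rw [map_zero, arr, ofPath_mul_of_ne h]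

variable (K T) in
/-- A path is normal if it is its own normal form. The normal paths form a basis of `A`. -/
def IsNormal (p : QPath T.Q) : Prop := T.normalForm K (T.ofPath K p) = PathAlgebra.ofPath K p

theorem IsNormal.triv (i : V) : T.IsNormal K (QPath.triv T.Q i) := normalForm_idem i

theorem ofPath_eq_zero_or_exists_isNormal (p : QPath T.Q) :
    T.ofPath K p = 0 ∨ ∃ u, T.IsNormal K u ∧ T.ofPath K p = T.ofPath K u := by
  induction p using QPath.cons_induction with
  | triv i => exact Or.inr ⟨_, IsNormal.triv i, rfl⟩
  | cons a p h ih =>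
    rw [← arr_mul_ofPath]
    obtain hp | ⟨u, hu, hp⟩ := ih
    · exact Or.inl (by rw [hp, mul_zero])
    rw [hp]
    obtain hau | ⟨q, -, hau⟩ := reduceCons_eq_zero_or K a u
    · exact Or.inl (by rw [← projAlgHom_reduceCons, hau, map_zero])
    have hq : T.arr K a * T.ofPath K u = T.ofPath K q := by
      rw [← projAlgHom_reduceCons, hau, projAlgHom_ofPath]
    exact Or.inr ⟨q, by rw [IsNormal, ← hq, normalForm_arr_mul, hu, arrowOp_ofPath, hau], hq⟩

theorem algHom_ext_isNormal {M : Type*} [AddCommGroup M] [Module K M] {f g : T.Alg K →ₗ[K] M}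
    (h : ∀ u, T.IsNormal K u → f (T.ofPath K u) = g (T.ofPath K u)) : f = g :=
  algHom_ext fun p => by
    obtain hp | ⟨u, hu, hp⟩ := ofPath_eq_zero_or_exists_isNormal (K := K) p
    · rw [hp, map_zero, map_zero]
    · rw [hp, h u hu]

end Triple

end NormalForms

/-! ### The bimodules `A ⊗ K Γ_n ⊗ A` -/

section Bimodules

namespace Triple

variable {K : Type uK} [Field K] {V : Type uV} {E : Type uE} {T : Triple V E} [Fintype V] {n : ℕ}

theorem env_mul_env (a b c d : T.Alg K) : T.env K a b * T.env K c d = T.env K (a * c) (d * b) :=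
  Algebra.TensorProduct.tmul_mul_tmul _ _ _ _

instance : IsScalarTower K (T.Env K) (T.Alg K) where
  smul_assoc c z x := by
    induction z using TensorProduct.induction_on with
    | zero =>
      have hzero : (0 : T.Env K) • x = 0 := zero_smul (T.Env K) x
      exact (congrArg (· • x) (smul_zero c)).trans (by rw [hzero, smul_zero])
    | tmul a b =>
      have henv : T.env K (c • a) b.unop • x = c • T.env K a b.unop • x := by
        simp only [env_smul, smul_mul_assoc]
      exact henv
    | add y z hy hz => rw [smul_add, add_smul, add_smul, hy, hz, smul_add]

variable (K) in
/-- The pure tensors of `A ⊗_K K Γ_n ⊗_K A` as a bilinear map in the two outer factors. -/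
def freeTensorₗ (γ : T.Gamma n) : T.Alg K →ₗ[K] T.Alg K →ₗ[K] T.FreeBimod K n :=
  ((TensorProduct.mk K (T.Alg K) (T.Alg K)ᵐᵒᵖ).compl₂
    (MulOpposite.opLinearEquiv K).toLinearMap).compr₂ (Finsupp.lsingle γ)

variable (K) in
/-- The pure tensors of `A ⊗ K Γ_n ⊗ A` as a bilinear map in the two outer factors. -/
def tensorₗ (γ : T.Gamma n) : T.Alg K →ₗ[K] T.Alg K →ₗ[K] T.P K n :=
  (freeTensorₗ K γ).compr₂ ((T.toP K n).restrictScalars K)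

theorem tensorₗ_apply (γ : T.Gamma n) (a b : T.Alg K) : tensorₗ K γ a b = T.tensor K a γ b := rfl

theorem freeTensor_zero_left (γ : T.Gamma n) (b : T.Alg K) : T.freeTensor K 0 γ b = 0 :=
  (freeTensorₗ K γ).map_zero₂ b

theorem freeTensor_zero_right (γ : T.Gamma n) (a : T.Alg K) : T.freeTensor K a γ 0 = 0 :=
  map_zero (freeTensorₗ K γ a)

@[simp] theorem tensor_zero_left (γ : T.Gamma n) (b : T.Alg K) : T.tensor K 0 γ b = 0 :=
  (tensorₗ K γ).map_zero₂ b

@[simp] theorem tensor_zero_right (γ : T.Gamma n) (a : T.Alg K) : T.tensor K a γ 0 = 0 :=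
  map_zero (tensorₗ K γ a)

@[simp] theorem env_smul_freeTensor (γ : T.Gamma n) (a b c d : T.Alg K) :
    T.env K a b • T.freeTensor K c γ d = T.freeTensor K (a * c) γ (d * b) := by
  rw [freeTensor, freeTensor, ← env_mul_env]
  exact Finsupp.smul_single (T.env K a b) γ (T.env K c d)

@[simp] theorem env_smul_tensor (γ : T.Gamma n) (a b c d : T.Alg K) :
    T.env K a b • T.tensor K c γ d = T.tensor K (a * c) γ (d * b) := by
  rw [tensor, tensor, ← map_smul, env_smul_freeTensor]

theorem tensor_eq_env_smul (γ : T.Gamma n) (a b : T.Alg K) :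
    T.tensor K a γ b = T.env K a b • T.tensor K 1 γ 1 := by
  rw [env_smul_tensor, mul_one, one_mul]

theorem tensor_mul_idem (γ : T.Gamma n) (a b : T.Alg K) :
    T.tensor K (a * T.idem K γ.path.tgt) γ b = T.tensor K a γ b := by
  have hmem : T.freeTensor K (a * T.idem K γ.path.tgt) γ b - T.freeTensor K a γ b ∈
      T.balance K n :=
    Submodule.subset_span (Or.inl ⟨a, b, γ, _, by rw [if_pos rfl]⟩)
  exact (Submodule.Quotient.eq _).2 hmem

theorem tensor_idem_mul (γ : T.Gamma n) (a b : T.Alg K) :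
    T.tensor K a γ (T.idem K γ.path.src * b) = T.tensor K a γ b := by
  have hmem : T.freeTensor K a γ (T.idem K γ.path.src * b) - T.freeTensor K a γ b ∈
      T.balance K n :=
    Submodule.subset_span (Or.inr ⟨a, b, γ, _, by rw [if_pos rfl]⟩)
  exact (Submodule.Quotient.eq _).2 hmem

theorem tensor_idem_idem (γ : T.Gamma n) :
    T.tensor K (T.idem K γ.path.tgt) γ (T.idem K γ.path.src) = T.tensor K 1 γ 1 := by
  rw [← one_mul (T.idem K γ.path.tgt), ← mul_one (T.idem K γ.path.src), tensor_mul_idem,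
    tensor_idem_mul]

theorem tensor_ofPath_of_ne (γ : T.Gamma n) (a : T.Alg K) {p : QPath T.Q}
    (h : γ.path.src ≠ p.tgt) : T.tensor K a γ (T.ofPath K p) = 0 := by
  rw [← tensor_idem_mul, idem_mul_ofPath, if_neg h, tensor_zero_right]

section FreeLift

variable {M : Type*} [AddCommGroup M] [Module K M]

/-- The linear map on `A ⊗_K K Γ_n ⊗_K A` given by bilinear maps indexed by `Γ_n`. -/
def freeLift (f : T.Gamma n → T.Alg K →ₗ[K] T.Alg K →ₗ[K] M) : T.FreeBimod K n →ₗ[K] M :=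
  Finsupp.lsum K fun γ =>
    TensorProduct.lift ((f γ).compl₂ (MulOpposite.opLinearEquiv K).symm.toLinearMap)

theorem freeLift_freeTensor (f : T.Gamma n → T.Alg K →ₗ[K] T.Alg K →ₗ[K] M) (γ : T.Gamma n)
    (a b : T.Alg K) : freeLift f (T.freeTensor K a γ b) = f γ a b :=
  (Finsupp.lsum_single _ _ _ _).trans (TensorProduct.lift.tmul _ _)

end FreeLift

section FreeDesc

variable {M : Type*} [AddCommGroup M] [Module (T.Env K) M]

/-- The bimodule map on `A ⊗_K K Γ_n ⊗_K A` with prescribed values on the generators. -/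
def freeDesc (m : T.Gamma n → M) : T.FreeBimod K n →ₗ[T.Env K] M :=
  Finsupp.linearCombination (T.Env K) m

theorem freeDesc_freeTensor (m : T.Gamma n → M) (γ : T.Gamma n) (a b : T.Alg K) :
    freeDesc m (T.freeTensor K a γ b) = T.env K a b • m γ :=
  Finsupp.linearCombination_single _ _ _

end FreeDesc

theorem balance_le_ker_freeDesc :
    T.balance K n ≤ LinearMap.ker (freeDesc (K := K) fun γ : T.Gamma n =>
      T.freeTensor K (T.idem K γ.path.tgt) γ (T.idem K γ.path.src)) := by
  refine Submodule.span_le.2 ?_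
  rintro x (⟨a, b, γ, i, rfl⟩ | ⟨a, b, γ, i, rfl⟩) <;>
    rw [SetLike.mem_coe, LinearMap.mem_ker, map_sub, sub_eq_zero] <;> split_ifs with h
  · subst h
    simp only [freeDesc_freeTensor, env_smul_freeTensor, mul_assoc, idem_mul_self]
  · rw [map_zero, freeDesc_freeTensor, env_smul_freeTensor, mul_assoc,
      idem_mul_of_ne (Ne.symm h), mul_zero, freeTensor_zero_left]
  · subst h
    simp only [freeDesc_freeTensor, env_smul_freeTensor, ← mul_assoc, idem_mul_self]
  · rw [map_zero, freeDesc_freeTensor, env_smul_freeTensor, ← mul_assoc, idem_mul_of_ne h,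
      zero_mul, freeTensor_zero_right]

namespace P

theorem toP_surjective : Function.Surjective (T.toP K n) := Submodule.mkQ_surjective _

@[elab_as_elim]
theorem induction {motive : T.P K n → Prop} (zero : motive 0)
    (tensor : ∀ a γ b, motive (T.tensor K a γ b))
    (add : ∀ x y, motive x → motive y → motive (x + y)) (x : T.P K n) : motive x := by
  obtain ⟨x, rfl⟩ := toP_surjective x
  induction x using Finsupp.induction_linear with
  | zero => exact (map_zero (T.toP K n)).symm ▸ zero
  | add x y hx hy => exact (map_add (T.toP K n) x y).symm ▸ add _ _ hx hy
  | single γ z =>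
    induction z using TensorProduct.induction_on with
    | zero =>
      rw [Finsupp.single_zero]
      exact (map_zero (T.toP K n)).symm ▸ zero
    | tmul a b => exact tensor a γ b.unop
    | add y z hy hz =>
      rw [Finsupp.single_add]
      exact (map_add (T.toP K n) _ _).symm ▸ add _ _ hy hz

theorem addHom_ext {M : Type*} [AddCommGroup M] {f g : T.P K n →+ M}
    (h : ∀ a γ b, f (T.tensor K a γ b) = g (T.tensor K a γ b)) : f = g := by
  ext x
  induction x using P.induction with
  | zero => rw [map_zero, map_zero]
  | tensor a γ b => exact h a γ b
  | add x y hx hy => rw [map_add, map_add, hx, hy]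

theorem linearMap_ext {M : Type*} [AddCommGroup M] [Module K M] {f g : T.P K n →ₗ[K] M}
    (h : ∀ p γ q, f (T.tensor K (T.ofPath K p) γ (T.ofPath K q)) =
      g (T.tensor K (T.ofPath K p) γ (T.ofPath K q))) : f = g := by
  refine LinearMap.toAddMonoidHom_injective (addHom_ext fun a γ b => ?_)
  have hγ : (tensorₗ K γ).compr₂ f = (tensorₗ K γ).compr₂ g :=
    algHom_ext fun p => algHom_ext fun q => h p γ q
  exact LinearMap.congr_fun₂ hγ a b

theorem hom_ext {M : Type*} [AddCommGroup M] [Module (T.Env K) M] {f g : T.P K n →ₗ[T.Env K] M}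
    (h : ∀ γ, f (T.tensor K 1 γ 1) = g (T.tensor K 1 γ 1)) : f = g := by
  refine LinearMap.toAddMonoidHom_injective (addHom_ext fun a γ b => ?_)
  rw [tensor_eq_env_smul]
  exact (f.map_smul _ _).trans ((congrArg _ (h γ)).trans (g.map_smul _ _).symm)

/-- The bimodule `A ⊗ K Γ_n ⊗ A` is the direct summand of `A ⊗_K K Γ_n ⊗_K A` spanned by the
tensors `a ⊗ γ ⊗ b` with `a = a e_{t(γ)}` and `b = e_{s(γ)} b`; this is its inclusion. -/
def toFree : T.P K n →ₗ[T.Env K] T.FreeBimod K n :=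
  (T.balance K n).liftQ _ balance_le_ker_freeDesc

theorem toFree_tensor (γ : T.Gamma n) (a b : T.Alg K) :
    toFree (T.tensor K a γ b) =
      T.freeTensor K (a * T.idem K γ.path.tgt) γ (T.idem K γ.path.src * b) := by
  rw [← env_smul_freeTensor, ← freeDesc_freeTensor (fun γ : T.Gamma n =>
    T.freeTensor K (T.idem K γ.path.tgt) γ (T.idem K γ.path.src))]
  rfl

instance projective : Module.Projective (T.Env K) (T.P K n) := by
  have hfree : Module.Projective (T.Env K) (T.FreeBimod K n) :=
    inferInstanceAs (Module.Projective (T.Env K) (T.Gamma n →₀ T.Env K))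
  refine Module.Projective.of_split toFree (T.toP K n) (hom_ext fun γ => ?_)
  rw [LinearMap.comp_apply, toFree_tensor, LinearMap.id_apply]
  exact (tensor_idem_mul _ _ _).trans (tensor_mul_idem _ _ _)

/-- The linear map on `A ⊗ K Γ_n ⊗ A` given by bilinear maps indexed by `Γ_n`; no compatibility
with the vertices is required, since the idempotents are inserted as in `lift_tensor`. -/
def lift {M : Type*} [AddCommGroup M] [Module K M]
    (f : T.Gamma n → T.Alg K →ₗ[K] T.Alg K →ₗ[K] M) : T.P K n →ₗ[K] M :=
  freeLift f ∘ₗ toFree.restrictScalars K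

theorem lift_tensor {M : Type*} [AddCommGroup M] [Module K M]
    (f : T.Gamma n → T.Alg K →ₗ[K] T.Alg K →ₗ[K] M) (γ : T.Gamma n) (a b : T.Alg K) :
    lift f (T.tensor K a γ b) = f γ (a * T.idem K γ.path.tgt) (T.idem K γ.path.src * b) := by
  rw [lift, LinearMap.comp_apply, LinearMap.restrictScalars_apply, toFree_tensor,
    freeLift_freeTensor]

/-- The bimodule map sending the generator of `γ` to `e_{t(γ)} (m γ) e_{s(γ)}`. -/
def desc {M : Type*} [AddCommGroup M] [Module (T.Env K) M] (m : T.Gamma n → M) :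
    T.P K n →ₗ[T.Env K] M :=
  freeDesc m ∘ₗ toFree

theorem desc_generator {M : Type*} [AddCommGroup M] [Module (T.Env K) M] (m : T.Gamma n → M)
    (γ : T.Gamma n) : desc m (T.tensor K 1 γ 1) =
      T.env K (T.idem K γ.path.tgt) (T.idem K γ.path.src) • m γ := by
  rw [desc, LinearMap.comp_apply, toFree_tensor, freeDesc_freeTensor, one_mul, mul_one]

end P

end Triple

end Bimodules

section GradedBimodules

namespace Triple

variable {K : Type uK} [Field K] {V : Type uV} {E : Type uE} {T : Triple V E} [Fintype V] {n : ℕ}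

theorem ofPath_mem_algGrading (p : QPath T.Q) : T.ofPath K p ∈ T.algGrading K (p.degree T.deg) :=
  Submodule.subset_span ⟨p, rfl, rfl⟩

theorem idem_mem_algGrading (i : V) : T.idem K i ∈ T.algGrading K 0 :=
  ofPath_mem_algGrading (QPath.triv T.Q i)

theorem arr_mem_algGrading (a : E) : T.arr K a ∈ T.algGrading K (T.deg a) := by
  have hmem := ofPath_mem_algGrading (K := K) (QPath.arrow T.Q a)
  have hdeg : (QPath.arrow T.Q a).degree T.deg = T.deg a := List.sum_singleton
  rwa [hdeg] at hmem

theorem one_mem_algGrading : (1 : T.Alg K) ∈ T.algGrading K 0 := by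
  rw [← sum_idem]
  exact Submodule.sum_mem _ fun i _ => idem_mem_algGrading i

theorem mul_mem_algGrading {i j : ℤ} {a b : T.Alg K} (ha : a ∈ T.algGrading K i)
    (hb : b ∈ T.algGrading K j) : a * b ∈ T.algGrading K (i + j) := by
  have mul_le : T.algGrading K i * T.algGrading K j ≤ T.algGrading K (i + j) := by
    rw [algGrading, algGrading, Submodule.span_mul_span, Submodule.span_le]
    rintro _ ⟨_, ⟨p, rfl, rfl⟩, _, ⟨q, rfl, rfl⟩, rfl⟩
    by_cases h : p.src = q.tgt
    · refine Submodule.subset_span ⟨p.comp q h, ?_, ofPath_mul_ofPath p q h⟩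
      simp [QPath.degree, QPath.comp]
    · simp only [ofPath_mul_of_ne h, SetLike.mem_coe, zero_mem]
  exact mul_le (Submodule.mul_mem_mul ha hb)

theorem iSup_algGrading : ⨆ k, T.algGrading K k = ⊤ := by
  rw [eq_top_iff, ← span_range_ofPath, Submodule.span_le]
  rintro _ ⟨p, rfl⟩
  exact Submodule.mem_iSup_of_mem _ (ofPath_mem_algGrading p)

variable (K T) in
/-- The realization of the quiver in the Laurent polynomials over `A` in which every arrow is
multiplied by the power of the variable given by its degree. -/
def degreeRealization : T.Q.Realization (AddMonoidAlgebra (T.Alg K) ℤ) where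
  vertex i := AddMonoidAlgebra.single 0 (T.idem K i)
  arrow a := AddMonoidAlgebra.single (T.deg a) (T.arr K a)
  vertex_mul_of_ne i j h := by
    rw [AddMonoidAlgebra.single_mul_single, idem_mul_of_ne h, AddMonoidAlgebra.single_zero]
  sum_vertex := by
    rw [AddMonoidAlgebra.one_def, ← sum_idem]
    exact (map_sum (AddMonoidAlgebra.singleAddHom (0 : ℤ)) _ _).symm
  vertex_mul_arrow a := by rw [AddMonoidAlgebra.single_mul_single, zero_add, idem_mul_arr]
  arrow_mul_vertex a := by rw [AddMonoidAlgebra.single_mul_single, add_zero, arr_mul_idem]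

theorem degreeRealization_ofPath (p : QPath T.Q) :
    (T.degreeRealization K).ofPath p =
      AddMonoidAlgebra.single (p.degree T.deg) (T.ofPath K p) := by
  induction p using QPath.cons_induction with
  | triv i => exact (T.degreeRealization K).ofPath_triv i
  | cons a p h ih =>
    rw [Quiv.Realization.ofPath_cons, ih, ← arr_mul_ofPath]
    exact AddMonoidAlgebra.single_mul_single _ _ _ _

theorem degreeRealization_arrow_mul_arrow {a b : E} (h : T.ZeroRel a b) :
    (T.degreeRealization K).arrow a * (T.degreeRealization K).arrow b = 0 := by
  simp only [degreeRealization, AddMonoidAlgebra.single_mul_single, arr_mul_arr_of_zeroRel h,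
    AddMonoidAlgebra.single_zero]

theorem degreeRealization_arrow_mul_self {ε : E} (hε : ε ∈ T.Sp) :
    (T.degreeRealization K).arrow ε * (T.degreeRealization K).arrow ε =
      (T.degreeRealization K).arrow ε := by
  simp only [degreeRealization, AddMonoidAlgebra.single_mul_single, arr_mul_self hε,
    T.deg_special ε hε, add_zero]

variable (K T) in
/-- The linear map on `A` that places a homogeneous element of degree `k` in degree `k`. -/
def algCoaction : T.Alg K →ₗ[K] ℤ →₀ T.Alg K :=
  (AddMonoidAlgebra.coeffLinearEquiv K).toLinearMap ∘ₗ
    (lift K (T.degreeRealization K) (fun _ _ => degreeRealization_arrow_mul_arrow)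
      (fun _ => degreeRealization_arrow_mul_self)).toLinearMap

theorem algCoaction_of_mem {k : ℤ} {x : T.Alg K} (hx : x ∈ T.algGrading K k) :
    T.algCoaction K x = Finsupp.single k x := by
  refine LinearMap.eqOn_span (g := Finsupp.lsingle k) ?_ hx
  rintro _ ⟨p, rfl, rfl⟩
  rw [algCoaction, LinearMap.comp_apply, AlgHom.toLinearMap_apply, lift_ofPath,
    degreeRealization_ofPath]
  rfl

variable (K T) in
theorem isGradedAlg_algGrading : IsGradedAlg (T.algGrading K) where
  one_mem := one_mem_algGrading
  mul_mem _ _ _ _ := mul_mem_algGrading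
  internal := isInternal_of_coaction iSup_algGrading (T.algCoaction K) fun _ _ => algCoaction_of_mem

variable (K T) in
theorem isGradedBimod_algGrading : IsGradedBimod (T.algGrading K) (T.algGrading K) where
  smul_mem i j k a b m ha hm hb := by
    have hmem := mul_mem_algGrading (mul_mem_algGrading ha hm) hb
    rwa [← env_smul] at hmem
  internal := (isGradedAlg_algGrading K T).internal

theorem tensor_mem_bimodGrading {i j k : ℤ} {a b : T.Alg K} (γ : T.Gamma n)
    (ha : a ∈ T.algGrading K i) (hb : b ∈ T.algGrading K j)
    (h : i + γ.path.degree T.deg + j = k) : T.tensor K a γ b ∈ T.bimodGrading K n k :=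
  Submodule.subset_span ⟨i, j, a, b, γ, ha, hb, h, rfl⟩

theorem iSup_bimodGrading : ⨆ k, T.bimodGrading K n k = ⊤ := by
  rw [← Submodule.ker_mkQ (⨆ k, T.bimodGrading K n k), LinearMap.ker_eq_top]
  exact P.linearMap_ext fun p γ q => (Submodule.Quotient.mk_eq_zero _).2 <|
    Submodule.mem_iSup_of_mem _ <|
      tensor_mem_bimodGrading γ (ofPath_mem_algGrading p) (ofPath_mem_algGrading q) rfl

/-- The bilinear map that places `a ⊗ γ ⊗ b`, for homogeneous `a` and `b`, in its degree. -/
def tensorCoaction (γ : T.Gamma n) : T.Alg K →ₗ[K] T.Alg K →ₗ[K] ℤ →₀ T.P K n :=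
  LinearMap.compl₁₂
    (Finsupp.lsum K fun i => LinearMap.flip (Finsupp.lsum K fun j => LinearMap.flip
      ((tensorₗ K γ).compr₂ (Finsupp.lsingle (i + γ.path.degree T.deg + j)))))
    (T.algCoaction K) (T.algCoaction K)

theorem tensorCoaction_apply (γ : T.Gamma n) {i j : ℤ} {a b : T.Alg K}
    (ha : a ∈ T.algGrading K i) (hb : b ∈ T.algGrading K j) :
    tensorCoaction γ a b =
      Finsupp.single (i + γ.path.degree T.deg + j) (T.tensor K a γ b) := by
  rw [tensorCoaction, LinearMap.compl₁₂_apply, algCoaction_of_mem ha, algCoaction_of_mem hb,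
    Finsupp.lsum_single, LinearMap.flip_apply, Finsupp.lsum_single]
  rfl

theorem lift_tensorCoaction_of_mem {k : ℤ} {x : T.P K n} (hx : x ∈ T.bimodGrading K n k) :
    P.lift tensorCoaction x = Finsupp.single k x := by
  refine LinearMap.eqOn_span (g := Finsupp.lsingle k) ?_ hx
  rintro _ ⟨i, j, a, b, γ, ha, hb, rfl, rfl⟩
  rw [P.lift_tensor, tensorCoaction_apply γ (mul_mem_algGrading ha (idem_mem_algGrading _))
    (mul_mem_algGrading (idem_mem_algGrading _) hb), tensor_mul_idem, tensor_idem_mul, add_zero,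
    zero_add, Finsupp.lsingle_apply]

variable (K T n) in
theorem isGradedBimod_bimodGrading : IsGradedBimod (T.algGrading K) (T.bimodGrading K n) where
  smul_mem i j k a b m ha hm hb := by
    have span_le : T.bimodGrading K n j ≤
        (T.bimodGrading K n (i + j + k)).comap (Algebra.lsmul K K (T.P K n) (T.env K a b)) := by
      refine Submodule.span_le.2 ?_
      rintro _ ⟨i', j', a', b', γ, ha', hb', rfl, rfl⟩
      change T.env K a b • T.tensor K a' γ b' ∈ T.bimodGrading K n _
      rw [env_smul_tensor]
      exact tensor_mem_bimodGrading γ (mul_mem_algGrading ha ha') (mul_mem_algGrading hb' hb)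
        (by ring)
    exact span_le hm
  internal := isInternal_of_coaction iSup_bimodGrading (P.lift tensorCoaction)
    fun _ _ => lift_tensorCoaction_of_mem

theorem generator_mem_bimodGrading (γ : T.Gamma n) :
    T.tensor K 1 γ 1 ∈ T.bimodGrading K n (γ.path.degree T.deg) :=
  tensor_mem_bimodGrading γ one_mem_algGrading one_mem_algGrading (by ring)

theorem preservesGrading_of_generator {M : Type*} [AddCommGroup M] [Module K M]
    [Module (T.Env K) M] [IsScalarTower K (T.Env K) M] {ℳ : ℤ → Submodule K M}
    (hM : IsGradedBimod (T.algGrading K) ℳ) (f : T.P K n →ₗ[T.Env K] M)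
    (hf : ∀ γ : T.Gamma n, f (T.tensor K 1 γ 1) ∈ ℳ (γ.path.degree T.deg)) :
    PreservesGrading (T.bimodGrading K n) ℳ f := by
  intro k
  have span_le : T.bimodGrading K n k ≤ (ℳ k).comap (f.restrictScalars K) := by
    refine Submodule.span_le.2 ?_
    rintro _ ⟨i, j, a, b, γ, ha, hb, rfl, rfl⟩
    rw [SetLike.mem_coe, Submodule.mem_comap, LinearMap.restrictScalars_apply,
      tensor_eq_env_smul, map_smul]
    exact hM.smul_mem i _ j a b _ ha (hf γ) hb
  exact span_le

variable (K T n) in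
theorem isGradedProjective_bimodGrading :
    IsGradedProjective.{w} (T.algGrading K) (T.bimodGrading K n) where
  graded := isGradedBimod_bimodGrading K T n
  projective := P.projective
  lifting X Y _ _ _ _ _ _ _ _ 𝒳 𝒴 hX hY g f hg hf hsurj := by
    have exists_preimage (γ : T.Gamma n) :
        ∃ x ∈ 𝒳 (γ.path.degree T.deg), g x = f (T.tensor K 1 γ 1) :=
      exists_homogeneous_lift hX.internal hY.internal (g := g.restrictScalars K) hg hsurj
        (hf _ _ (generator_mem_bimodGrading γ))
    choose x hx hgx using exists_preimage
    refine ⟨P.desc x, preservesGrading_of_generator hX _ fun γ => ?_, P.hom_ext fun γ => ?_⟩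
    · rw [P.desc_generator]
      have hmem := hX.smul_mem 0 _ 0 _ _ _ (idem_mem_algGrading (K := K) γ.path.tgt) (hx γ)
        (idem_mem_algGrading γ.path.src)
      rwa [zero_add, add_zero] at hmem
    · rw [LinearMap.comp_apply, P.desc_generator, map_smul, hgx, ← map_smul, env_smul_tensor,
        mul_one, one_mul, tensor_idem_idem]

end Triple

end GradedBimodules

/-! ### The paths in `Γ_n` -/

section Walks

variable {V : Type uV} {E : Type uE} {Q : Quiv V E}

theorem Quiv.IsWalk.src_eq_of_append {u v : List E} {a b : E} {j i : V}
    (h : Q.IsWalk j (u ++ a :: b :: v) i) : Q.src a = Q.tgt b := by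
  induction u generalizing j with
  | nil => exact h.2.1.symm
  | cons c u ih => exact ih h.2

theorem Quiv.IsWalk.eq_tgt_head {l : List E} {j i : V} (h : Q.IsWalk j l i) (hl : l ≠ []) :
    j = Q.tgt (l.head hl) := by
  cases l with
  | nil => exact absurd rfl hl
  | cons a l => exact h.1.symm

theorem Quiv.IsWalk.eq_src_getLast {l : List E} {j i : V} (h : Q.IsWalk j l i) (hl : l ≠ []) :
    i = Q.src (l.getLast hl) := by
  induction l generalizing j with
  | nil => exact absurd rfl hl
  | cons a l ih =>
    cases l with
    | nil => exact h.2.symm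
    | cons b l =>
      rw [List.getLast_cons (List.cons_ne_nil b l)]
      exact ih h.2 (List.cons_ne_nil b l)

theorem QPath.ext_word {p q : QPath Q} (hp : p.word ≠ []) (h : p.word = q.word) : p = q := by
  obtain ⟨j, l, i, hw⟩ := p
  obtain ⟨j', l', i', hw'⟩ := q
  cases h
  cases (hw.eq_tgt_head hp).trans (hw'.eq_tgt_head hp).symm
  cases (hw.eq_src_getLast hp).trans (hw'.eq_src_getLast hp).symm
  rfl

end Walks

namespace Triple

variable {V : Type uV} {E : Type uE} {T : Triple V E} {n : ℕ} {ε : E}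

theorem eq_of_isChain_rel_of_mem {l : List E} (hl : l.IsChain T.Rel) (hε : ε ∈ T.Sp)
    (h : ε ∈ l) : ∀ a ∈ l, a = ε := by
  induction l with
  | nil => exact fun _ ha => absurd ha List.not_mem_nil
  | cons b l ih =>
    cases l with
    | nil => exact fun a ha => (List.mem_singleton.1 ha).trans (List.mem_singleton.1 h).symm
    | cons c l =>
      obtain ⟨hbc, hl⟩ := List.isChain_cons_cons.1 hl
      have hmem : ε ∈ c :: l := by
        obtain rfl | h := List.mem_cons.1 h
        · exact hbc.eq_of_left_mem hε ▸ List.mem_cons_self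
        · exact h
      have hall := ih hl hmem
      obtain rfl : c = ε := hall c List.mem_cons_self
      exact List.forall_mem_cons.2 ⟨hbc.eq_of_right_mem hε, hall⟩

namespace Gamma

section Words

variable (q : T.Gamma (n + 1))

theorem length_word (γ : T.Gamma n) : γ.path.word.length = n := γ.2.1

theorem isChain_word (γ : T.Gamma n) : γ.path.word.IsChain T.Rel := by
  refine List.isChain_iff_forall_rel_of_append_cons_cons.2 fun {a b u v} h => ?_
  have hab : T.Q.src a = T.Q.tgt b := (h ▸ γ.path.isWalk).src_eq_of_append
  have hsubpath : (QPath.two a b hab).word <:+: γ.path.word :=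
    ⟨u, v, (List.append_assoc _ _ _).trans h.symm⟩
  exact ⟨hab, γ.2.2 _ rfl hsubpath⟩

theorem mem_of_isChain_word {p : QPath T.Q} (hp : p.word.IsChain T.Rel) (q : QPath T.Q)
    (hq : q.length = 2) (h : q.word <:+: p.word) : q ∈ T.S := by
  obtain ⟨a, b, hab, rfl⟩ := QPath.exists_eq_two hq
  exact (List.isChain_cons_cons.1 (hp.infix h)).1.2

theorem ext_word {q q' : T.Gamma (n + 1)} (h : q.path.word = q'.path.word) : q = q' :=
  Subtype.ext (QPath.ext_word q.word_ne_nil h)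

theorem path_tgt : q.path.tgt = T.Q.tgt q.leftArrow := q.path.isWalk.eq_tgt_head _

theorem path_src : q.path.src = T.Q.src q.rightArrow := q.path.isWalk.eq_src_getLast _

theorem rightArrow_mem : q.rightArrow ∈ q.path.word := List.getLast_mem _

theorem leftArrow_mem : q.leftArrow ∈ q.path.word := List.head_mem _

theorem dropLeft_word : q.dropLeft.path.word = q.path.word.tail := QPath.dropLeft_word _

theorem dropRight_word : q.dropRight.path.word = q.path.word.dropLast := QPath.dropRight_word _

theorem word_eq_cons : q.path.word = q.leftArrow :: q.dropLeft.path.word := by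
  rw [dropLeft_word, leftArrow, List.cons_head_tail]

theorem word_eq_concat : q.path.word = q.dropRight.path.word ++ [q.rightArrow] := by
  rw [dropRight_word, rightArrow, List.dropLast_append_getLast]

theorem leftArrow_eq {q : T.Gamma (n + 1)} {a : E} {l : List E} (h : q.path.word = a :: l) :
    q.leftArrow = a := by
  rw [word_eq_cons] at h
  exact (List.cons.inj h).1

theorem rightArrow_eq {q : T.Gamma (n + 1)} {a : E} {l : List E} (h : q.path.word = l ++ [a]) :
    q.rightArrow = a := by
  rw [word_eq_concat] at h
  exact (List.append_singleton_inj.1 h).2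

theorem dropLeft_src : q.dropLeft.path.src = q.path.src := by
  obtain ⟨⟨j, _ | ⟨a, l⟩, i, hw⟩, h⟩ := q <;> rfl

theorem dropRight_tgt : q.dropRight.path.tgt = q.path.tgt := by
  obtain ⟨⟨j, _ | ⟨a, l⟩, i, hw⟩, h⟩ := q <;> rfl

theorem dropLeft_tgt : q.dropLeft.path.tgt = T.Q.src q.leftArrow := by
  obtain ⟨⟨j, _ | ⟨a, l⟩, i, hw⟩, h⟩ := q
  · exact absurd rfl (word_ne_nil ⟨_, h⟩)
  · rfl

theorem dropRight_src : q.dropRight.path.src = T.Q.tgt q.rightArrow := by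
  obtain ⟨⟨j, _ | ⟨a, l⟩, i, hw⟩, h⟩ := q
  · exact absurd rfl (word_ne_nil ⟨_, h⟩)
  · rfl

theorem degree_eq_left (deg : E → ℤ) :
    q.path.degree deg = deg q.leftArrow + q.dropLeft.path.degree deg := by
  rw [QPath.degree, q.word_eq_cons, List.map_cons, List.sum_cons, QPath.degree]

theorem degree_eq_right (deg : E → ℤ) :
    q.path.degree deg = q.dropRight.path.degree deg + deg q.rightArrow := by
  rw [QPath.degree, q.word_eq_concat, List.map_append, List.sum_append, List.map_singleton,
    List.sum_singleton, QPath.degree]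

end Words

section LengthAtLeastTwo

variable (q : T.Gamma (n + 2))

theorem rightArrow_dropLeft : q.dropLeft.rightArrow = q.rightArrow := by
  symm
  apply rightArrow_eq (l := q.leftArrow :: q.dropLeft.dropRight.path.word)
  rw [List.cons_append, ← word_eq_concat, ← word_eq_cons]

theorem leftArrow_dropRight : q.dropRight.leftArrow = q.leftArrow := by
  symm
  apply leftArrow_eq (l := q.dropRight.dropLeft.path.word ++ [q.rightArrow])
  rw [← List.cons_append, ← word_eq_cons, ← word_eq_concat]

theorem dropLeft_dropRight : q.dropLeft.dropRight = q.dropRight.dropLeft := by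
  refine Subtype.ext (QPath.ext ?_ ?_ ?_)
  · change q.dropLeft.dropRight.path.tgt = q.dropRight.dropLeft.path.tgt
    rw [dropRight_tgt, dropLeft_tgt, dropLeft_tgt, leftArrow_dropRight]
  · change q.dropLeft.dropRight.path.word = q.dropRight.dropLeft.path.word
    rw [dropRight_word, dropLeft_word, dropLeft_word, dropRight_word, List.tail_dropLast]
  · change q.dropLeft.dropRight.path.src = q.dropRight.dropLeft.path.src
    rw [dropRight_src, dropLeft_src, dropRight_src, rightArrow_dropLeft]

theorem rel_left : T.Rel q.leftArrow q.dropLeft.leftArrow := by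
  have h := q.isChain_word
  rw [word_eq_cons, word_eq_cons q.dropLeft] at h
  exact (List.isChain_cons_cons.1 h).1

theorem rel_right : T.Rel q.dropRight.rightArrow q.rightArrow := by
  have h := q.isChain_word
  rw [word_eq_concat, word_eq_concat q.dropRight, List.append_assoc] at h
  exact (List.isChain_cons_cons.1 (List.isChain_append.1 h).2.1).1

end LengthAtLeastTwo

/-- The path `γ b`, where `b` satisfies a relation with the rightmost arrow of `γ`. -/
def snoc (γ : T.Gamma (n + 1)) (b : E) (h : T.Rel γ.rightArrow b) : T.Gamma (n + 2) :=
  ⟨γ.path.comp (QPath.arrow T.Q b) (γ.path_src.trans h.1),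
    by
      rw [QPath.length, QPath.comp, List.length_append, γ.length_word]
      rfl,
    mem_of_isChain_word (by
      refine List.isChain_append.2 ⟨γ.isChain_word, List.isChain_singleton b, fun x hx y hy => ?_⟩
      rw [word_eq_concat, List.getLast?_concat, Option.mem_some_iff] at hx
      rw [QPath.arrow, List.head?_cons, Option.mem_some_iff] at hy
      exact hx ▸ hy ▸ h)⟩

section Snoc

variable (γ : T.Gamma (n + 1)) (b : E) (h : T.Rel γ.rightArrow b)

theorem snoc_word : (γ.snoc b h).path.word = γ.path.word ++ [b] := rfl

theorem path_tgt_snoc : (γ.snoc b h).path.tgt = γ.path.tgt := rfl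

theorem rightArrow_snoc : (γ.snoc b h).rightArrow = b := rightArrow_eq (γ.snoc_word b h)

theorem leftArrow_snoc : (γ.snoc b h).leftArrow = γ.leftArrow :=
  leftArrow_eq (l := γ.dropLeft.path.word ++ [b]) (by rw [snoc_word, word_eq_cons]; rfl)

theorem dropRight_snoc : (γ.snoc b h).dropRight = γ :=
  ext_word (by rw [dropRight_word, snoc_word, List.dropLast_concat])

end Snoc

theorem dropLeft_snoc (γ : T.Gamma (n + 2)) (b : E) (h : T.Rel γ.rightArrow b) :
    (γ.snoc b h).dropLeft = γ.dropLeft.snoc b (γ.rightArrow_dropLeft.symm ▸ h) :=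
  ext_word (by
    rw [dropLeft_word, snoc_word, snoc_word, dropLeft_word,
      List.tail_append_of_ne_nil γ.word_ne_nil])

theorem snoc_dropRight (γ : T.Gamma (n + 2)) : γ.dropRight.snoc γ.rightArrow γ.rel_right = γ :=
  ext_word (by rw [snoc_word, ← word_eq_concat])

section SpPow

variable (hε : ε ∈ T.Sp)

theorem spPow_word : (spPow hε n).path.word = List.replicate n ε := rfl

theorem leftArrow_spPow : (spPow hε (n + 1)).leftArrow = ε := leftArrow_eq rfl

theorem rightArrow_spPow : (spPow hε (n + 1)).rightArrow = ε :=
  rightArrow_eq (l := List.replicate n ε) (by rw [spPow_word, List.replicate_succ'])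

theorem dropLeft_spPow : (spPow hε (n + 1)).dropLeft = spPow hε n :=
  Subtype.ext (QPath.ext (T.loop ε hε) rfl rfl)

theorem dropRight_spPow : (spPow hε (n + 1)).dropRight = spPow hε n := by
  refine Subtype.ext (QPath.ext rfl ?_ ?_)
  · change (spPow hε (n + 1)).dropRight.path.word = _
    rw [dropRight_word, spPow_word, List.dropLast_replicate]
    rfl
  · change (spPow hε (n + 1)).dropRight.path.src = _
    rw [dropRight_src, rightArrow_spPow]
    exact (T.loop ε hε).symm

theorem eq_spPow_of_mem (q : T.Gamma (n + 1)) (h : ε ∈ q.path.word) : q = spPow hε (n + 1) :=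
  ext_word (List.eq_replicate_iff.2
    ⟨q.length_word, eq_of_isChain_rel_of_mem q.isChain_word hε h⟩)

end SpPow

section Special

variable (q : T.Gamma (n + 1))

theorem eq_spPow_of_rightArrow_mem (h : q.rightArrow ∈ T.Sp) : q = spPow h (n + 1) :=
  q.eq_spPow_of_mem h q.rightArrow_mem

theorem path_mem_spPowers_iff : q.path ∈ spPowers T.Q T.Sp (n + 1) ↔ q.rightArrow ∈ T.Sp := by
  refine ⟨?_, fun h =>
    ⟨q.rightArrow, h, T.loop _ h, congrArg path (q.eq_spPow_of_rightArrow_mem h)⟩⟩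
  rintro ⟨ε, hε, hloop, hq⟩
  obtain rfl : q = spPow hε (n + 1) := Subtype.ext hq
  rwa [rightArrow_spPow]

theorem leftArrow_eq_rightArrow (h : q.rightArrow ∈ T.Sp) : q.leftArrow = q.rightArrow := by
  have hleft := congrArg leftArrow (q.eq_spPow_of_rightArrow_mem h)
  rwa [leftArrow_spPow] at hleft

theorem dropLeft_eq_dropRight (h : q.rightArrow ∈ T.Sp) : q.dropLeft = q.dropRight := by
  have hq := q.eq_spPow_of_rightArrow_mem h
  have hleft := congrArg dropLeft hq
  have hright := congrArg dropRight hq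
  rw [dropLeft_spPow] at hleft
  rw [dropRight_spPow] at hright
  rw [hleft, hright]

theorem dropLeft_snoc_self (h : q.rightArrow ∈ T.Sp) :
    (q.snoc q.rightArrow (rel_self h)).dropLeft = q := by
  rw [dropLeft_eq_dropRight _ (by rwa [rightArrow_snoc]), dropRight_snoc]

theorem leftArrow_notMem (h : q.rightArrow ∉ T.Sp) : q.leftArrow ∉ T.Sp := fun hleft => h (by
  have hright := congrArg rightArrow (q.eq_spPow_of_mem hleft q.leftArrow_mem)
  rwa [hright, rightArrow_spPow])

theorem rightArrow_dropRight_notMem (q : T.Gamma (n + 2)) (h : q.rightArrow ∉ T.Sp) :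
    q.dropRight.rightArrow ∉ T.Sp := fun hright => h (by
  rwa [q.rel_right.eq_of_left_mem hright])

end Special

/-- An arrow as an element of `Γ_1`. -/
def ofArrow (T : Triple V E) (a : E) : T.Gamma 1 :=
  ⟨QPath.arrow T.Q a, rfl, mem_of_isChain_word (List.isChain_singleton a)⟩

/-- A vertex as an element of `Γ_0`. -/
def ofVertex (T : Triple V E) (i : V) : T.Gamma 0 :=
  ⟨QPath.triv T.Q i, rfl, mem_of_isChain_word List.isChain_nil⟩

theorem eq_ofVertex (γ : T.Gamma 0) : γ = ofVertex T γ.path.tgt :=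
  Subtype.ext (QPath.eq_triv_of_word_eq_nil (List.length_eq_zero_iff.1 γ.length_word))

theorem eq_ofArrow (γ : T.Gamma 1) : γ = ofArrow T γ.rightArrow :=
  ext_word (by
    rw [word_eq_concat, List.length_eq_zero_iff.1 γ.dropRight.length_word]
    rfl)

theorem leftArrow_one (γ : T.Gamma 1) : γ.leftArrow = γ.rightArrow := by
  rw [γ.eq_ofArrow]
  rfl

theorem dropLeft_snoc_one (γ : T.Gamma 1) (b : E) (h : T.Rel γ.rightArrow b) :
    (γ.snoc b h).dropLeft = ofArrow T b :=
  (eq_ofArrow _).trans (by rw [rightArrow_dropLeft, rightArrow_snoc])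

end Gamma

end Triple

/-! ### The differential -/

section Differential

namespace Triple

variable {K : Type uK} [Field K] {V : Type uV} {E : Type uE} {T : Triple V E} [Fintype V] {n : ℕ}

variable (K) in
open Classical in
/-- The value of the differential on the generator `1 ⊗ γ ⊗ 1`. The powers of special loops need
no separate formula for odd exponents. -/
def boundary (γ : T.Gamma (n + 1)) : T.P K n :=
  T.tensor K (T.arr K γ.leftArrow) γ.dropLeft 1 +
    (-1 : ℤ) ^ (n + 1) • T.tensor K 1 γ.dropRight (T.arr K γ.rightArrow) -
    if γ.rightArrow ∈ T.Sp ∧ Even (n + 1) then T.tensor K 1 γ.dropLeft 1 else 0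

theorem boundary_of_notMem {γ : T.Gamma (n + 1)} (h : γ.rightArrow ∉ T.Sp) :
    boundary K γ = T.tensor K (T.arr K γ.leftArrow) γ.dropLeft 1 +
      (-1 : ℤ) ^ (n + 1) • T.tensor K 1 γ.dropRight (T.arr K γ.rightArrow) := by
  rw [boundary, if_neg fun h' => h h'.1, sub_zero]

theorem boundary_spPow_of_odd {ε : E} (hε : ε ∈ T.Sp) (hn : Odd (n + 1)) :
    boundary K (Gamma.spPow hε (n + 1)) =
      T.tensor K (T.arr K ε) (Gamma.spPow hε n) 1 -
        T.tensor K 1 (Gamma.spPow hε n) (T.arr K ε) := by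
  rw [boundary, Gamma.leftArrow_spPow, Gamma.rightArrow_spPow, Gamma.dropLeft_spPow,
    Gamma.dropRight_spPow, hn.neg_one_pow, neg_one_smul,
    if_neg fun h => Nat.not_even_iff_odd.2 hn h.2, sub_zero, sub_eq_add_neg]

theorem boundary_spPow_of_even {ε : E} (hε : ε ∈ T.Sp) (hn : Even (n + 1)) :
    boundary K (Gamma.spPow hε (n + 1)) =
      T.tensor K (T.arr K ε) (Gamma.spPow hε n) 1 + T.tensor K 1 (Gamma.spPow hε n) (T.arr K ε) -
        T.tensor K 1 (Gamma.spPow hε n) 1 := by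
  rw [boundary, Gamma.leftArrow_spPow, Gamma.rightArrow_spPow, Gamma.dropLeft_spPow,
    Gamma.dropRight_spPow, hn.neg_one_pow, one_smul, if_pos ⟨hε, hn⟩]

theorem env_idem_smul_boundary (γ : T.Gamma (n + 1)) :
    T.env K (T.idem K γ.path.tgt) (T.idem K γ.path.src) • boundary K γ = boundary K γ := by
  classical
  have hleft : T.tensor K (T.idem K γ.path.tgt * T.arr K γ.leftArrow) γ.dropLeft
      (1 * T.idem K γ.path.src) = T.tensor K (T.arr K γ.leftArrow) γ.dropLeft 1 := by
    rw [γ.path_tgt, idem_mul_arr, one_mul, ← γ.dropLeft_src,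
      ← mul_one (T.idem K γ.dropLeft.path.src), tensor_idem_mul]
  have hright : T.tensor K (T.idem K γ.path.tgt * 1) γ.dropRight
      (T.arr K γ.rightArrow * T.idem K γ.path.src) =
        T.tensor K 1 γ.dropRight (T.arr K γ.rightArrow) := by
    rw [γ.path_src, arr_mul_idem, mul_one, ← γ.dropRight_tgt,
      ← one_mul (T.idem K γ.dropRight.path.tgt), tensor_mul_idem]
  rw [boundary, smul_sub, smul_add, smul_comm _ ((-1 : ℤ) ^ (n + 1)), env_smul_tensor,
    env_smul_tensor, hleft, hright]
  congr 1
  split_ifs with h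
  · have htgt : γ.dropLeft.path.tgt = γ.path.tgt := by
      rw [γ.dropLeft_eq_dropRight h.1, γ.dropRight_tgt]
    rw [env_smul_tensor, mul_one, one_mul, ← γ.dropLeft_src, ← htgt, tensor_idem_idem]
  · exact smul_zero _

theorem env_idem_smul_ofPath (p : QPath T.Q) :
    T.env K (T.idem K p.tgt) (T.idem K p.src) • T.ofPath K p = T.ofPath K p := by
  rw [env_smul, idem_mul_ofPath, if_pos rfl, ofPath_mul_idem, if_pos rfl]

theorem boundary_mem_bimodGrading (γ : T.Gamma (n + 1)) :
    boundary K γ ∈ T.bimodGrading K n (γ.path.degree T.deg) := by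
  classical
  refine Submodule.sub_mem _ (Submodule.add_mem _ ?_ (zsmul_mem ?_ _)) ?_
  · exact tensor_mem_bimodGrading _ (arr_mem_algGrading _) one_mem_algGrading
      (by rw [γ.degree_eq_left, add_zero])
  · exact tensor_mem_bimodGrading _ one_mem_algGrading (arr_mem_algGrading _)
      (by rw [γ.degree_eq_right, zero_add])
  · split_ifs with h
    · refine tensor_mem_bimodGrading _ one_mem_algGrading one_mem_algGrading ?_
      rw [γ.degree_eq_left, γ.leftArrow_eq_rightArrow h.1, T.deg_special _ h.1, add_zero]
    · exact Submodule.zero_mem _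

theorem exists_isDifferential : ∃ (d₀ : T.P K 0 →ₗ[T.Env K] T.Alg K)
    (d : ∀ n : ℕ, T.P K (n + 1) →ₗ[T.Env K] T.P K n), T.IsDifferential K d₀ d := by
  have generator : ∀ (n : ℕ) (γ : T.Gamma (n + 1)),
      P.desc (boundary K) (T.tensor K 1 γ 1) = boundary K γ := fun n γ =>
    (P.desc_generator _ γ).trans (env_idem_smul_boundary γ)
  exact ⟨P.desc fun γ => T.ofPath K γ.path, fun n => P.desc (boundary K),
    fun γ => (P.desc_generator _ γ).trans (env_idem_smul_ofPath γ.path),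
    fun n γ hγ => (generator n γ).trans
      (boundary_of_notMem fun h => hγ (γ.path_mem_spPowers_iff.2 h)),
    fun n ε hε hn => (generator n _).trans (boundary_spPow_of_odd hε hn),
    fun n ε hε hn => (generator n _).trans (boundary_spPow_of_even hε hn)⟩

namespace IsDifferential

variable {d₀ : T.P K 0 →ₗ[T.Env K] T.Alg K} {d : ∀ n : ℕ, T.P K (n + 1) →ₗ[T.Env K] T.P K n}

theorem apply_generator (hd : T.IsDifferential K d₀ d) (γ : T.Gamma (n + 1)) :
    d n (T.tensor K 1 γ 1) = boundary K γ := by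
  by_cases h : γ.rightArrow ∈ T.Sp
  · rw [γ.eq_spPow_of_rightArrow_mem h]
    obtain hn | hn := Nat.even_or_odd (n + 1)
    · rw [hd.special_even n _ h hn, boundary_spPow_of_even h hn]
    · rw [hd.special_odd n _ h hn, boundary_spPow_of_odd h hn]
  · rw [hd.nonspecial n γ fun h' => h (γ.path_mem_spPowers_iff.1 h'), boundary_of_notMem h]

theorem apply_tensor (hd : T.IsDifferential K d₀ d) (γ : T.Gamma (n + 1)) (a b : T.Alg K) :
    d n (T.tensor K a γ b) = open Classical in
      T.tensor K (a * T.arr K γ.leftArrow) γ.dropLeft b +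
        (-1 : ℤ) ^ (n + 1) • T.tensor K a γ.dropRight (T.arr K γ.rightArrow * b) -
        if γ.rightArrow ∈ T.Sp ∧ Even (n + 1) then T.tensor K a γ.dropLeft b else 0 := by
  classical
  rw [tensor_eq_env_smul, map_smul, hd.apply_generator, boundary, smul_sub, smul_add,
    smul_comm _ ((-1 : ℤ) ^ (n + 1)), smul_ite, smul_zero]
  simp only [env_smul_tensor, one_mul, mul_one]

theorem apply_tensor_of_notMem (hd : T.IsDifferential K d₀ d) {γ : T.Gamma (n + 1)}
    (h : γ.rightArrow ∉ T.Sp) (a b : T.Alg K) :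
    d n (T.tensor K a γ b) = T.tensor K (a * T.arr K γ.leftArrow) γ.dropLeft b +
        (-1 : ℤ) ^ (n + 1) • T.tensor K a γ.dropRight (T.arr K γ.rightArrow * b) := by
  rw [hd.apply_tensor, if_neg fun h' => h h'.1, sub_zero]

theorem apply_tensor_spPow_of_odd (hd : T.IsDifferential K d₀ d) {ε : E} (hε : ε ∈ T.Sp)
    (hn : Odd (n + 1)) (a b : T.Alg K) :
    d n (T.tensor K a (Gamma.spPow hε (n + 1)) b) =
      T.tensor K (a * T.arr K ε) (Gamma.spPow hε n) b -
        T.tensor K a (Gamma.spPow hε n) (T.arr K ε * b) := by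
  rw [tensor_eq_env_smul, map_smul, hd.special_odd n ε hε hn, smul_sub]
  simp only [env_smul_tensor, one_mul, mul_one]

theorem apply_tensor_spPow_of_even (hd : T.IsDifferential K d₀ d) {ε : E} (hε : ε ∈ T.Sp)
    (hn : Even (n + 1)) (a b : T.Alg K) :
    d n (T.tensor K a (Gamma.spPow hε (n + 1)) b) =
      T.tensor K (a * T.arr K ε) (Gamma.spPow hε n) b +
          T.tensor K a (Gamma.spPow hε n) (T.arr K ε * b) -
        T.tensor K a (Gamma.spPow hε n) b := by
  rw [tensor_eq_env_smul, map_smul, hd.special_even n ε hε hn, smul_sub, smul_add]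
  simp only [env_smul_tensor, one_mul, mul_one]

theorem augmentation_tensor (hd : T.IsDifferential K d₀ d) (i : V) (a b : T.Alg K) :
    d₀ (T.tensor K a (Gamma.ofVertex T i) b) = a * T.idem K i * b := by
  rw [tensor_eq_env_smul, map_smul, hd.augmentation]
  exact T.env_smul K _ _ _

theorem apply_ofArrow (hd : T.IsDifferential K d₀ d) (c : E) (a b : T.Alg K) :
    d 0 (T.tensor K a (Gamma.ofArrow T c) b) =
      T.tensor K (a * T.arr K c) (Gamma.ofVertex T (T.Q.src c)) b -
        T.tensor K a (Gamma.ofVertex T (T.Q.tgt c)) (T.arr K c * b) := by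
  have h := hd.apply_tensor (Gamma.ofArrow T c) a b
  rw [if_neg fun h => Nat.not_even_one h.2, sub_zero, Odd.neg_one_pow (by simp), neg_one_smul,
    ← sub_eq_add_neg] at h
  exact h

theorem augmentation_comp (hd : T.IsDifferential K d₀ d) : d₀ ∘ₗ d 0 = 0 :=
  P.hom_ext fun γ => by
    rw [γ.eq_ofArrow, LinearMap.comp_apply, hd.apply_ofArrow, map_sub,
      hd.augmentation_tensor, hd.augmentation_tensor, one_mul, one_mul, mul_one, mul_one,
      arr_mul_idem, idem_mul_arr, sub_self]
    rfl

theorem comp_apply_spPow (hd : T.IsDifferential K d₀ d) {ε : E} (hε : ε ∈ T.Sp) :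
    d n (d (n + 1) (T.tensor K 1 (Gamma.spPow hε (n + 2)) 1)) = 0 := by
  obtain hn | hn := Nat.even_or_odd (n + 1)
  · rw [hd.special_odd _ ε hε hn.add_one, map_sub]
    simp only [hd.apply_tensor_spPow_of_even hε hn, one_mul, mul_one, arr_mul_self hε]
    abel
  · rw [hd.special_even _ ε hε hn.add_one, map_sub, map_add]
    simp only [hd.apply_tensor_spPow_of_odd hε hn, one_mul, mul_one, arr_mul_self hε]
    abel

theorem comp_apply_of_notMem (hd : T.IsDifferential K d₀ d) {γ : T.Gamma (n + 2)}
    (h : γ.rightArrow ∉ T.Sp) : d n (d (n + 1) (T.tensor K 1 γ 1)) = 0 := by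
  have hleft : γ.dropLeft.rightArrow ∉ T.Sp := by rwa [γ.rightArrow_dropLeft]
  have hright := γ.rightArrow_dropRight_notMem h
  rw [hd.apply_tensor_of_notMem h, map_add, map_zsmul, hd.apply_tensor_of_notMem hleft,
    hd.apply_tensor_of_notMem hright, one_mul, one_mul, mul_one, mul_one,
    arr_mul_arr_of_zeroRel (γ.rel_left.zeroRel (γ.leftArrow_notMem h)),
    arr_mul_arr_of_zeroRel (γ.rel_right.zeroRel hright), γ.dropLeft_dropRight,
    γ.rightArrow_dropLeft, γ.leftArrow_dropRight, tensor_zero_left, tensor_zero_right,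
    smul_zero, zero_add, add_zero, pow_succ _ (n + 1), mul_neg_one, neg_smul, add_neg_cancel]

theorem comp (hd : T.IsDifferential K d₀ d) (n : ℕ) : d n ∘ₗ d (n + 1) = 0 :=
  P.hom_ext fun γ => by
    by_cases h : γ.rightArrow ∈ T.Sp
    · rw [γ.eq_spPow_of_rightArrow_mem h]
      exact hd.comp_apply_spPow h
    · exact hd.comp_apply_of_notMem h

end IsDifferential

end Triple

end Differential

/-! ### Left linear maps given on normal paths -/

section LeftLift

namespace Triple

variable {K : Type uK} [Field K] {V : Type uV} {E : Type uE} {T : Triple V E} [Fintype V] {n m : ℕ}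

theorem env_smul_env_smul {M : Type*} [AddCommGroup M] [Module (T.Env K) M] (a b c d : T.Alg K)
    (x : M) : T.env K a b • T.env K c d • x = T.env K (a * c) (d * b) • x := by
  rw [smul_smul, env_mul_env]

theorem env_zero_smul {M : Type*} [AddCommGroup M] [Module (T.Env K) M] (b : T.Alg K) (x : M) :
    T.env K 0 b • x = 0 := by
  rw [env, TensorProduct.zero_tmul]
  exact zero_smul (T.Env K) x

/-- The left linear map on `A ⊗ K Γ_n ⊗ A` given by `a ⊗ γ ⊗ u ↦ a e_{t(γ)} (F γ u)` for normal
paths `u` that end at `s(γ)`. -/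
def leftLift (F : T.Gamma n → QPath T.Q → T.P K m) : T.P K n →ₗ[K] T.P K m :=
  P.lift fun γ => LinearMap.mk₂ K
    (fun a b => T.env K a 1 • PathAlgebra.extend (F γ) (T.normalForm K b))
    (fun a a' b => by rw [env, TensorProduct.add_tmul, add_smul]; rfl)
    (fun c a b => by rw [env, ← TensorProduct.smul_tmul', smul_assoc]; rfl)
    (fun a b b' => by rw [map_add, map_add, smul_add])
    (fun c a b => by rw [map_smul, map_smul, smul_algebra_smul_comm])

variable (F : T.Gamma n → QPath T.Q → T.P K m)

theorem leftLift_tensor (a : T.Alg K) (γ : T.Gamma n) (b : T.Alg K) :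
    leftLift F (T.tensor K a γ b) = T.env K (a * T.idem K γ.path.tgt) 1 •
      PathAlgebra.extend (F γ) (T.normalForm K (T.idem K γ.path.src * b)) :=
  P.lift_tensor _ γ a b

theorem leftLift_tensor_of_isNormal (γ : T.Gamma n) {u : QPath T.Q} (hu : T.IsNormal K u)
    (h : γ.path.src = u.tgt) :
    leftLift F (T.tensor K 1 γ (T.ofPath K u)) = T.env K (T.idem K γ.path.tgt) 1 • F γ u := by
  rw [leftLift_tensor, one_mul, idem_mul_ofPath, if_pos h, hu, PathAlgebra.extend_ofPath]

theorem leftLift_env_smul (a : T.Alg K) (x : T.P K n) :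
    leftLift F (T.env K a 1 • x) = T.env K a 1 • leftLift F x := by
  induction x using P.induction with
  | zero => rw [smul_zero, map_zero, smul_zero]
  | add x y hx hy => rw [smul_add, map_add, map_add, hx, hy, smul_add]
  | tensor c γ b =>
    rw [env_smul_tensor, leftLift_tensor, leftLift_tensor, env_smul_env_smul, mul_one, mul_one,
      mul_assoc]

theorem eq_self_of_isNormal {g : T.P K n →ₗ[K] T.P K n}
    (hg : ∀ a x, g (T.env K a 1 • x) = T.env K a 1 • g x)
    (h : ∀ (γ : T.Gamma n) (u : QPath T.Q), T.IsNormal K u → γ.path.src = u.tgt →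
      g (T.tensor K 1 γ (T.ofPath K u)) = T.tensor K 1 γ (T.ofPath K u)) (x : T.P K n) :
    g x = x := by
  induction x using P.induction with
  | zero => exact map_zero _
  | add x y hx hy => rw [map_add, hx, hy]
  | tensor a γ b =>
    have hone : T.tensor K a γ b = T.env K a 1 • T.tensor K 1 γ b := by
      rw [env_smul_tensor, mul_one, mul_one]
    have hfix : g ∘ₗ tensorₗ K γ 1 = tensorₗ K γ 1 := algHom_ext_isNormal fun u hu => by
      by_cases hsrc : γ.path.src = u.tgt
      · exact h γ u hu hsrc
      · rw [LinearMap.comp_apply, tensorₗ_apply, tensor_ofPath_of_ne γ 1 hsrc, map_zero]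
    rw [hone, hg]
    exact congrArg _ (LinearMap.congr_fun hfix b)

end Triple

end LeftLift

/-! ### The contracting homotopy -/

section Homotopy

namespace Triple

variable {K : Type uK} [Field K] {V : Type uV} {E : Type uE} {T : Triple V E} [Fintype V] {n : ℕ}

variable (K) in
/-- The sum of `v ⊗ c ⊗ w` over the factorizations `v c w` of a walk with an arrow `c`. -/
def walkDerivation : ∀ {j : V} {w : List E} {i : V}, T.Q.IsWalk j w i → T.P K 1
  | _, [], _, _ => 0
  | _, a :: _, _, h => T.env K (T.arr K a) 1 • walkDerivation h.2 +
      T.tensor K 1 (Gamma.ofArrow T a) (T.ofPath K ⟨_, _, _, h.2⟩)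

variable (K) in
/-- The universal derivation of a path: the sum of `v ⊗ c ⊗ w` over its factorizations `v c w` with
an arrow `c`. It does not factor through `A`. -/
def pathDerivation (p : QPath T.Q) : T.P K 1 := walkDerivation K p.isWalk

theorem pathDerivation_triv (i : V) : pathDerivation K (QPath.triv T.Q i) = 0 := rfl

theorem pathDerivation_cons (a : E) (p : QPath T.Q) (h : T.Q.src a = p.tgt) :
    pathDerivation K (QPath.cons a p h) = T.env K (T.arr K a) 1 • pathDerivation K p +
      T.tensor K 1 (Gamma.ofArrow T a) (T.ofPath K p) := by
  obtain ⟨j, w, i, hw⟩ := p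
  cases h
  rfl

theorem env_idem_smul_pathDerivation (p : QPath T.Q) :
    T.env K (T.idem K p.tgt) 1 • pathDerivation K p = pathDerivation K p := by
  induction p using QPath.cons_induction with
  | triv i => rw [pathDerivation_triv, smul_zero]
  | cons a p h =>
    have htgt : T.idem K (QPath.cons a p h).tgt * T.arr K a = T.arr K a := idem_mul_arr a
    have htensor := tensor_mul_idem (Gamma.ofArrow T a) 1 (T.ofPath K p)
    rw [one_mul] at htensor
    rw [pathDerivation_cons, smul_add, env_smul_env_smul, env_smul_tensor, htgt, mul_one, mul_one,
      mul_one]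
    exact congrArg _ htensor

variable (K) in
open Classical in
/-- The tensor `1 ⊗ γ b ⊗ u'` if the path `u = b u'` starts with an arrow `b` by which `γ` can be
extended, and `0` otherwise. -/
def moveArrow (γ : T.Gamma (n + 1)) : QPath T.Q → T.P K (n + 2)
  | ⟨_, [], _, _⟩ => 0
  | ⟨_, b :: _, _, h⟩ =>
    if hb : T.Rel γ.rightArrow b then T.tensor K 1 (γ.snoc b hb) (T.ofPath K ⟨_, _, _, h.2⟩) else 0

theorem moveArrow_cons (γ : T.Gamma (n + 1)) {b : E} (p : QPath T.Q) (h : T.Q.src b = p.tgt)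
    (hb : T.Rel γ.rightArrow b) :
    moveArrow K γ (QPath.cons b p h) = T.tensor K 1 (γ.snoc b hb) (T.ofPath K p) := by
  obtain ⟨j, w, i, hw⟩ := p
  cases h
  exact dif_pos hb

theorem moveArrow_of_not_rel (γ : T.Gamma (n + 1)) {p : QPath T.Q}
    (h : ∀ b, p.word.head? = some b → ¬ T.Rel γ.rightArrow b) : moveArrow K γ p = 0 := by
  obtain ⟨j, _ | ⟨b, w⟩, i, hw⟩ := p
  · rfl
  · exact dif_neg (h b rfl)

variable (K) in
open Classical in
/-- The value on `1 ⊗ γ ⊗ p`, for a normal path `p`, of the contracting homotopy in positive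
degrees. As a degenerate loop is zero in `A`, its powers are instead matched in pairs by the
summand `-1 ⊗ ε^n ⊗ 1` of the differential. -/
def homotopyValue (γ : T.Gamma (n + 1)) (p : QPath T.Q) : T.P K (n + 2) :=
  if h : T.IsDegenerate γ.rightArrow then
    if Even n then -T.tensor K 1 (γ.snoc γ.rightArrow (rel_self h.1)) (T.ofPath K p) else 0
  else (-1 : ℤ) ^ n • moveArrow K γ p

theorem env_idem_smul_homotopyValue (γ : T.Gamma (n + 1)) (p : QPath T.Q) :
    T.env K (T.idem K γ.path.tgt) 1 • homotopyValue K γ p = homotopyValue K γ p := by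
  classical
  have hsnoc : ∀ b h x, T.env K (T.idem K γ.path.tgt) 1 • T.tensor K 1 (γ.snoc b h) x =
      T.tensor K 1 (γ.snoc b h) x := fun b h x => by
    rw [env_smul_tensor, mul_one, mul_one, ← γ.path_tgt_snoc b h, ← tensor_mul_idem _ 1, one_mul]
  have hmove : T.env K (T.idem K γ.path.tgt) 1 • moveArrow K γ p = moveArrow K γ p := by
    by_cases h : ∃ b, p.word.head? = some b ∧ T.Rel γ.rightArrow b
    · obtain ⟨b, hb, hrel⟩ := h
      obtain ⟨p, hp, rfl⟩ := QPath.exists_eq_cons hb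
      rw [moveArrow_cons γ p hp hrel, hsnoc]
    · rw [moveArrow_of_not_rel γ fun b hb hrel => h ⟨b, hb, hrel⟩, smul_zero]
  rw [homotopyValue]
  split_ifs
  · rw [smul_neg, hsnoc]
  · exact smul_zero _
  · rw [smul_comm, hmove]

variable (K T) in
/-- The contracting homotopy of the resolution. -/
def homotopy : ∀ n : ℕ, T.P K n →ₗ[K] T.P K (n + 1)
  | 0 => leftLift fun _ p => -pathDerivation K p
  | _ + 1 => leftLift (homotopyValue K)

theorem homotopy_env_smul (a : T.Alg K) (x : T.P K n) :
    T.homotopy K n (T.env K a 1 • x) = T.env K a 1 • T.homotopy K n x := by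
  cases n <;> exact leftLift_env_smul _ a x

variable {u : QPath T.Q}

theorem homotopy_zero_tensor (hu : T.IsNormal K u) (γ : T.Gamma 0) (h : γ.path.src = u.tgt) :
    T.homotopy K 0 (T.tensor K 1 γ (T.ofPath K u)) = -pathDerivation K u := by
  have htgt : γ.path.tgt = u.tgt := by
    rw [γ.eq_ofVertex] at h ⊢
    exact h
  rw [homotopy, leftLift_tensor_of_isNormal _ γ hu h, smul_neg, htgt, env_idem_smul_pathDerivation]

theorem homotopy_succ_tensor (hu : T.IsNormal K u) (γ : T.Gamma (n + 1))
    (h : γ.path.src = u.tgt) :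
    T.homotopy K (n + 1) (T.tensor K 1 γ (T.ofPath K u)) = homotopyValue K γ u := by
  rw [homotopy, leftLift_tensor_of_isNormal _ γ hu h, env_idem_smul_homotopyValue]

end Triple

end Homotopy

/-! ### Exactness -/

section Exactness

namespace Triple

variable {K : Type uK} [Field K] {V : Type uV} {E : Type uE} {T : Triple V E} [Fintype V] {n : ℕ}
  {u : QPath T.Q}

theorem IsNormal.cons {a : E} (hu : T.IsNormal K u) (h : T.Q.src a = u.tgt)
    (hdeg : ¬ T.IsDegenerate a) (hrel : ∀ b, u.word.head? = some b → ¬ T.Rel a b) :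
    T.IsNormal K (QPath.cons a u h) := by
  rw [IsNormal, ← arr_mul_ofPath, normalForm_arr_mul, hu, arrowOp_ofPath,
    reduceCons_of_not_rel hdeg h hrel]

theorem homotopy_of_isDegenerate_of_even (hu : T.IsNormal K u) (γ : T.Gamma (n + 1))
    (hsrc : γ.path.src = u.tgt) (hdeg : T.IsDegenerate γ.rightArrow) (hn : Even n) :
    T.homotopy K (n + 1) (T.tensor K 1 γ (T.ofPath K u)) =
      -T.tensor K 1 (γ.snoc γ.rightArrow (rel_self hdeg.1)) (T.ofPath K u) := by
  rw [homotopy_succ_tensor hu γ hsrc, homotopyValue, dif_pos hdeg, if_pos hn]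

theorem homotopy_of_isDegenerate_of_odd (hu : T.IsNormal K u) (γ : T.Gamma (n + 1))
    (hsrc : γ.path.src = u.tgt) (hdeg : T.IsDegenerate γ.rightArrow) (hn : Odd n) :
    T.homotopy K (n + 1) (T.tensor K 1 γ (T.ofPath K u)) = 0 := by
  rw [homotopy_succ_tensor hu γ hsrc, homotopyValue, dif_pos hdeg,
    if_neg (Nat.not_even_iff_odd.2 hn)]

theorem homotopy_of_rel {b : E} {hb : T.Q.src b = u.tgt} (hu : T.IsNormal K (QPath.cons b u hb))
    (γ : T.Gamma (n + 1)) (hdeg : ¬ T.IsDegenerate γ.rightArrow) (hrel : T.Rel γ.rightArrow b) :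
    T.homotopy K (n + 1) (T.tensor K 1 γ (T.ofPath K (QPath.cons b u hb))) =
      (-1 : ℤ) ^ n • T.tensor K 1 (γ.snoc b hrel) (T.ofPath K u) := by
  rw [homotopy_succ_tensor hu γ (γ.path_src.trans hrel.1), homotopyValue, dif_neg hdeg,
    moveArrow_cons γ u hb hrel]

theorem homotopy_of_not_rel (hu : T.IsNormal K u) (γ : T.Gamma (n + 1))
    (hsrc : γ.path.src = u.tgt) (hdeg : ¬ T.IsDegenerate γ.rightArrow)
    (hrel : ∀ b, u.word.head? = some b → ¬ T.Rel γ.rightArrow b) :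
    T.homotopy K (n + 1) (T.tensor K 1 γ (T.ofPath K u)) = 0 := by
  rw [homotopy_succ_tensor hu γ hsrc, homotopyValue, dif_neg hdeg, moveArrow_of_not_rel γ hrel,
    smul_zero]

theorem homotopy_dropLeft_of_isDegenerate (hu : T.IsNormal K u) (γ : T.Gamma (n + 1))
    (hsrc : γ.path.src = u.tgt) (hdeg : T.IsDegenerate γ.rightArrow) (hn : Odd n) :
    T.homotopy K n (T.tensor K 1 γ.dropLeft (T.ofPath K u)) =
      -T.tensor K 1 γ (T.ofPath K u) := by
  obtain _ | n := n
  · exact absurd hn Nat.not_odd_zero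
  have hdrop : T.IsDegenerate γ.dropLeft.rightArrow := γ.rightArrow_dropLeft.symm ▸ hdeg
  have hsnoc : γ.dropLeft.snoc γ.dropLeft.rightArrow (rel_self hdrop.1) = γ :=
    Gamma.ext_word (by
      rw [Gamma.snoc_word, γ.rightArrow_dropLeft, γ.dropLeft_eq_dropRight hdeg.1,
        γ.word_eq_concat])
  rw [homotopy_of_isDegenerate_of_even hu _ (γ.dropLeft_src.trans hsrc) hdrop
    (Nat.not_odd_iff_even.1 (Nat.odd_add_one.1 hn)), hsnoc]

theorem homotopy_dropRight_of_not_rel (hu : T.IsNormal K u) (γ : T.Gamma (n + 1))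
    (hsrc : T.Q.src γ.rightArrow = u.tgt) (hdeg : ¬ T.IsDegenerate γ.rightArrow)
    (hrel : ∀ b, u.word.head? = some b → ¬ T.Rel γ.rightArrow b) :
    T.homotopy K n (T.tensor K 1 γ.dropRight (T.arr K γ.rightArrow * T.ofPath K u)) =
      T.env K (T.arr K γ.leftArrow) 1 • T.homotopy K n (T.tensor K 1 γ.dropLeft (T.ofPath K u)) +
        (-1 : ℤ) ^ (n + 1) • T.tensor K 1 γ (T.ofPath K u) := by
  have hcons := hu.cons hsrc hdeg hrel
  have hdropLeft : γ.dropLeft.path.src = u.tgt := (γ.dropLeft_src.trans γ.path_src).trans hsrc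
  rw [arr_mul_ofPath _ _ hsrc]
  obtain _ | n := n
  · rw [homotopy_zero_tensor hcons _ γ.dropRight_src, homotopy_zero_tensor hu _ hdropLeft,
      pathDerivation_cons, ← γ.eq_ofArrow, γ.leftArrow_one, Odd.neg_one_pow (by simp),
      neg_one_smul, smul_neg, neg_add]
  · have hdegRight : ¬ T.IsDegenerate γ.dropRight.rightArrow := fun h =>
      hdeg ((γ.rel_right.eq_of_left_mem h.1).symm ▸ h)
    have hdegLeft : ¬ T.IsDegenerate γ.dropLeft.rightArrow := γ.rightArrow_dropLeft.symm ▸ hdeg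
    have hrelLeft : ∀ b, u.word.head? = some b → ¬ T.Rel γ.dropLeft.rightArrow b :=
      γ.rightArrow_dropLeft.symm ▸ hrel
    rw [homotopy_of_rel hcons _ hdegRight γ.rel_right, γ.snoc_dropRight,
      homotopy_of_not_rel hu _ hdropLeft hdegLeft hrelLeft, smul_zero, zero_add, pow_succ,
      pow_succ, mul_neg_one, mul_neg_one, neg_neg]

theorem homotopy_dropLeft_of_not_rel (hu : T.IsNormal K u) (γ : T.Gamma (n + 1))
    (hsrc : γ.path.src = u.tgt) (hdeg : ¬ T.IsDegenerate γ.rightArrow)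
    (hrel : ∀ b, u.word.head? = some b → ¬ T.Rel γ.rightArrow b) (hn : Odd n) :
    T.homotopy K n (T.tensor K 1 γ.dropLeft (T.ofPath K u)) = 0 := by
  obtain _ | n := n
  · exact absurd hn Nat.not_odd_zero
  rw [← γ.rightArrow_dropLeft] at hdeg hrel
  exact homotopy_of_not_rel hu _ (γ.dropLeft_src.trans hsrc) hdeg hrel

section Rel

variable {b : E} {hb : T.Q.src b = u.tgt}

theorem homotopy_zero_of_rel (hu : T.IsNormal K (QPath.cons b u hb)) (γ : T.Gamma 1)
    (hrel : T.Rel γ.rightArrow b) :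
    T.homotopy K 0 (T.tensor K 1 γ.dropLeft (T.ofPath K (QPath.cons b u hb))) =
      -(T.env K (T.arr K b) 1 • pathDerivation K u +
        T.tensor K 1 (γ.snoc b hrel).dropLeft (T.ofPath K u)) := by
  rw [homotopy_zero_tensor hu _ ((γ.dropLeft_src.trans γ.path_src).trans hrel.1),
    pathDerivation_cons, γ.dropLeft_snoc_one]

theorem homotopy_succ_of_rel (hu : T.IsNormal K (QPath.cons b u hb)) (γ : T.Gamma (n + 2))
    (hdeg : ¬ T.IsDegenerate γ.rightArrow) (hrel : T.Rel γ.rightArrow b) :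
    T.homotopy K (n + 1) (T.tensor K 1 γ.dropLeft (T.ofPath K (QPath.cons b u hb))) =
      (-1 : ℤ) ^ n • T.tensor K 1 (γ.snoc b hrel).dropLeft (T.ofPath K u) := by
  rw [← γ.rightArrow_dropLeft] at hdeg
  rw [homotopy_of_rel hu _ hdeg (γ.rightArrow_dropLeft.symm ▸ hrel), γ.dropLeft_snoc]

end Rel

namespace IsDifferential

variable {d₀ : T.P K 0 →ₗ[T.Env K] T.Alg K} {d : ∀ n : ℕ, T.P K (n + 1) →ₗ[T.Env K] T.P K n}

theorem homotopy_apply (hd : T.IsDifferential K d₀ d) (γ : T.Gamma (n + 1)) (b : T.Alg K) :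
    T.homotopy K n (d n (T.tensor K 1 γ b)) = open Classical in
      T.env K (T.arr K γ.leftArrow) 1 • T.homotopy K n (T.tensor K 1 γ.dropLeft b) +
        (-1 : ℤ) ^ (n + 1) • T.homotopy K n (T.tensor K 1 γ.dropRight (T.arr K γ.rightArrow * b)) -
        if γ.rightArrow ∈ T.Sp ∧ Even (n + 1) then
          T.homotopy K n (T.tensor K 1 γ.dropLeft b) else 0 := by
  classical
  rw [hd.apply_tensor, map_sub, map_add, map_zsmul, apply_ite (T.homotopy K n), map_zero,
    ← homotopy_env_smul, env_smul_tensor, one_mul, mul_one, mul_one]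

theorem homotopy_identity_of_isDegenerate (hd : T.IsDifferential K d₀ d) (hu : T.IsNormal K u)
    (γ : T.Gamma (n + 1)) (hsrc : γ.path.src = u.tgt) (hdeg : T.IsDegenerate γ.rightArrow) :
    d (n + 1) (T.homotopy K (n + 1) (T.tensor K 1 γ (T.ofPath K u))) +
        T.homotopy K n (d n (T.tensor K 1 γ (T.ofPath K u))) =
      T.tensor K 1 γ (T.ofPath K u) := by
  rw [hd.homotopy_apply, γ.leftArrow_eq_rightArrow hdeg.1, hdeg.arr_eq_zero, env_zero_smul,
    zero_mul, tensor_zero_right, map_zero, smul_zero, add_zero, zero_sub]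
  obtain hn | hn := Nat.even_or_odd n
  · rw [homotopy_of_isDegenerate_of_even hu γ hsrc hdeg hn, map_neg, hd.apply_tensor,
      Gamma.rightArrow_snoc, Gamma.leftArrow_snoc, γ.leftArrow_eq_rightArrow hdeg.1,
      hdeg.arr_eq_zero, Gamma.dropLeft_snoc_self _ hdeg.1,
      if_pos ⟨hdeg.1, hn.add_one.add_one⟩, if_neg fun h => Nat.not_even_iff_odd.2 hn.add_one h.2,
      mul_zero, zero_mul, tensor_zero_left, tensor_zero_right]
    simp
  · rw [homotopy_of_isDegenerate_of_odd hu γ hsrc hdeg hn, map_zero, zero_add,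
      if_pos ⟨hdeg.1, hn.add_one⟩, homotopy_dropLeft_of_isDegenerate hu γ hsrc hdeg hn, neg_neg]

theorem homotopy_identity_of_not_rel (hd : T.IsDifferential K d₀ d) (hu : T.IsNormal K u)
    (γ : T.Gamma (n + 1)) (hsrc : γ.path.src = u.tgt) (hdeg : ¬ T.IsDegenerate γ.rightArrow)
    (hrel : ∀ b, u.word.head? = some b → ¬ T.Rel γ.rightArrow b) :
    d (n + 1) (T.homotopy K (n + 1) (T.tensor K 1 γ (T.ofPath K u))) +
        T.homotopy K n (d n (T.tensor K 1 γ (T.ofPath K u))) =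
      T.tensor K 1 γ (T.ofPath K u) := by
  classical
  have hodd : (if γ.rightArrow ∈ T.Sp ∧ Even (n + 1) then
      T.homotopy K n (T.tensor K 1 γ.dropLeft (T.ofPath K u)) else 0) = 0 :=
    ite_eq_right_iff.2 fun h => homotopy_dropLeft_of_not_rel hu γ hsrc hdeg hrel
      (Nat.not_even_iff_odd.1 (Nat.even_add_one.1 h.2))
  rw [hd.homotopy_apply, hodd, homotopy_of_not_rel hu γ hsrc hdeg hrel,
    homotopy_dropRight_of_not_rel hu γ (γ.path_src.symm.trans hsrc) hdeg hrel, map_zero, zero_add,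
    sub_zero, smul_add, smul_smul, ← mul_pow, neg_one_mul, neg_neg, one_pow, one_smul,
    ← add_assoc, add_eq_right]
  obtain hn | hn := Nat.even_or_odd n
  · rw [hn.add_one.neg_one_pow, neg_one_smul, add_neg_cancel]
  · rw [homotopy_dropLeft_of_not_rel hu γ hsrc hdeg hrel hn, smul_zero, smul_zero, add_zero]

section Rel

variable {b : E} {hb : T.Q.src b = u.tgt}

theorem apply_homotopy_of_rel (hd : T.IsDifferential K d₀ d)
    (hu : T.IsNormal K (QPath.cons b u hb)) (γ : T.Gamma (n + 1))
    (hdeg : ¬ T.IsDegenerate γ.rightArrow) (hrel : T.Rel γ.rightArrow b) :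
    d (n + 1) (T.homotopy K (n + 1) (T.tensor K 1 γ (T.ofPath K (QPath.cons b u hb)))) =
      open Classical in
      (-1 : ℤ) ^ n • T.tensor K (T.arr K γ.leftArrow) (γ.snoc b hrel).dropLeft (T.ofPath K u) +
        T.tensor K 1 γ (T.ofPath K (QPath.cons b u hb)) -
        if b ∈ T.Sp ∧ Even n then T.tensor K 1 (γ.snoc b hrel).dropLeft (T.ofPath K u) else 0 := by
  classical
  have heven : Even (n + 1 + 1) ↔ Even n := by rw [Nat.even_add_one, Nat.even_add_one, not_not]
  have hsign : (-1 : ℤ) ^ n * (-1) ^ (n + 1 + 1) = 1 := by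
    rw [← pow_add]
    exact Even.neg_one_pow (by grind)
  rw [homotopy_of_rel hu γ hdeg hrel, map_zsmul, hd.apply_tensor, Gamma.dropRight_snoc,
    Gamma.leftArrow_snoc, Gamma.rightArrow_snoc, arr_mul_ofPath _ _ hb, one_mul, smul_sub, smul_add,
    smul_smul, hsign, one_smul]
  simp only [heven]
  congr 1
  split_ifs with h
  · rw [h.2.neg_one_pow, one_smul]
  · exact smul_zero _

theorem homotopy_identity_of_rel_of_notMem (hd : T.IsDifferential K d₀ d)
    (hu : T.IsNormal K (QPath.cons b u hb)) (γ : T.Gamma (n + 1)) (hγ : γ.rightArrow ∉ T.Sp)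
    (hrel : T.Rel γ.rightArrow b) :
    d (n + 1) (T.homotopy K (n + 1) (T.tensor K 1 γ (T.ofPath K (QPath.cons b u hb)))) +
        T.homotopy K n (d n (T.tensor K 1 γ (T.ofPath K (QPath.cons b u hb)))) =
      T.tensor K 1 γ (T.ofPath K (QPath.cons b u hb)) := by
  have hdeg : ¬ T.IsDegenerate γ.rightArrow := fun h => hγ h.1
  have hbSp : b ∉ T.Sp := fun h => hγ ((hrel.eq_of_right_mem h).symm ▸ h)
  have hzero : T.arr K γ.rightArrow * T.ofPath K (QPath.cons b u hb) = 0 := by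
    rw [← arr_mul_ofPath, ← mul_assoc, arr_mul_arr_of_zeroRel (hrel.zeroRel hγ), zero_mul]
  rw [hd.apply_homotopy_of_rel hu γ hdeg hrel, hd.homotopy_apply, hzero, tensor_zero_right,
    map_zero, smul_zero, add_zero, if_neg fun h => hbSp h.1, if_neg fun h => hγ h.1, sub_zero,
    sub_zero]
  obtain _ | n := n
  · rw [homotopy_zero_of_rel hu γ hrel, smul_neg, smul_add, env_smul_env_smul, γ.leftArrow_one,
      arr_mul_arr_of_zeroRel (hrel.zeroRel hγ), env_zero_smul, env_smul_tensor, mul_one, mul_one,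
      pow_zero, one_smul]
    abel
  · rw [homotopy_succ_of_rel hu γ hdeg hrel, smul_comm, env_smul_tensor, mul_one, mul_one, pow_succ,
      mul_neg_one, neg_smul]
    abel

theorem homotopy_identity_of_rel_of_mem (hd : T.IsDifferential K d₀ d)
    (hu : T.IsNormal K (QPath.cons b u hb)) (γ : T.Gamma (n + 1)) (hγ : γ.rightArrow ∈ T.Sp)
    (hdeg : ¬ T.IsDegenerate γ.rightArrow) (hrel : T.Rel γ.rightArrow b) :
    d (n + 1) (T.homotopy K (n + 1) (T.tensor K 1 γ (T.ofPath K (QPath.cons b u hb)))) +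
        T.homotopy K n (d n (T.tensor K 1 γ (T.ofPath K (QPath.cons b u hb)))) =
      T.tensor K 1 γ (T.ofPath K (QPath.cons b u hb)) := by
  obtain rfl := hrel.eq_of_left_mem hγ
  have habsorb : T.arr K γ.rightArrow * T.ofPath K (QPath.cons γ.rightArrow u hb) =
      T.ofPath K (QPath.cons γ.rightArrow u hb) := by
    rw [← arr_mul_ofPath, ← mul_assoc, arr_mul_self hγ]
  rw [hd.apply_homotopy_of_rel hu γ hdeg hrel, hd.homotopy_apply, habsorb,
    ← γ.dropLeft_eq_dropRight hγ, γ.leftArrow_eq_rightArrow hγ]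
  obtain _ | n := n
  · rw [homotopy_zero_of_rel hu γ hrel, smul_neg, smul_add, env_smul_env_smul, arr_mul_self hγ,
      env_smul_tensor, mul_one, mul_one, mul_one, if_pos ⟨hγ, Even.zero⟩,
      if_neg fun h => Nat.not_even_one h.2, pow_zero, Odd.neg_one_pow (by simp), one_smul,
      neg_one_smul]
    abel
  · rw [homotopy_succ_of_rel hu γ hdeg hrel, smul_comm, env_smul_tensor, mul_one, mul_one,
      smul_smul, ← pow_add]
    obtain hn | hn := Nat.even_or_odd n
    · rw [if_neg fun h => Nat.not_even_iff_odd.2 hn.add_one h.2, if_pos ⟨hγ, hn.add_one.add_one⟩,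
        hn.neg_one_pow, hn.add_one.neg_one_pow, Even.neg_one_pow (by grind)]
      simp only [one_smul, neg_one_smul]
      abel
    · rw [if_pos ⟨hγ, hn.add_one⟩, if_neg fun h => Nat.not_even_iff_odd.2 hn.add_one.add_one h.2,
        hn.neg_one_pow, hn.add_one.neg_one_pow, Even.neg_one_pow (by grind)]
      simp only [one_smul, neg_one_smul]
      abel

end Rel

theorem homotopy_identity (hd : T.IsDifferential K d₀ d) (x : T.P K (n + 1)) :
    d (n + 1) (T.homotopy K (n + 1) x) + T.homotopy K n (d n x) = x := by
  refine eq_self_of_isNormal (g := (d (n + 1)).restrictScalars K ∘ₗ T.homotopy K (n + 1) +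
    T.homotopy K n ∘ₗ (d n).restrictScalars K) (fun a x => ?_) (fun γ u hu hsrc => ?_) x
  · simp only [LinearMap.add_apply, LinearMap.comp_apply, LinearMap.restrictScalars_apply,
      map_smul, homotopy_env_smul, smul_add]
  change d (n + 1) (T.homotopy K (n + 1) _) + T.homotopy K n (d n _) = _
  by_cases hdeg : T.IsDegenerate γ.rightArrow
  · exact hd.homotopy_identity_of_isDegenerate hu γ hsrc hdeg
  by_cases hrel : ∃ b, u.word.head? = some b ∧ T.Rel γ.rightArrow b
  · obtain ⟨b, hb, hrel⟩ := hrel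
    obtain ⟨u, hbu, rfl⟩ := QPath.exists_eq_cons hb
    by_cases hγ : γ.rightArrow ∈ T.Sp
    · exact hd.homotopy_identity_of_rel_of_mem hu γ hγ hdeg hrel
    · exact hd.homotopy_identity_of_rel_of_notMem hu γ hγ hrel
  · exact hd.homotopy_identity_of_not_rel hu γ hsrc hdeg fun b hb hab => hrel ⟨b, hb, hab⟩

end IsDifferential

variable (K T) in
/-- The map `b ↦ b ⊗ 1`, the contracting homotopy in degree `-1`. -/
def augmentationSection : T.Alg K →ₗ[K] T.P K 0 := ∑ i : V, (tensorₗ K (Gamma.ofVertex T i)).flip 1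

theorem augmentationSection_apply (b : T.Alg K) :
    T.augmentationSection K b = ∑ i : V, T.tensor K b (Gamma.ofVertex T i) 1 := by
  rw [augmentationSection, LinearMap.sum_apply]
  rfl

theorem augmentationSection_mul (a b : T.Alg K) :
    T.augmentationSection K (a * b) = T.env K a 1 • T.augmentationSection K b := by
  simp only [augmentationSection_apply, Finset.smul_sum, env_smul_tensor, mul_one]

theorem augmentationSection_idem (i : V) :
    T.augmentationSection K (T.idem K i) = T.tensor K 1 (Gamma.ofVertex T i) (T.idem K i) := by
  have hne (j : V) (hj : j ≠ i) : T.tensor K (T.idem K i) (Gamma.ofVertex T j) 1 = 0 := by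
    rw [← tensor_mul_idem]
    exact (congrArg (T.tensor K · _ 1) (idem_mul_of_ne hj.symm)).trans (tensor_zero_left _ 1)
  have hleft := tensor_mul_idem (K := K) (Gamma.ofVertex T i) 1 1
  have hright := tensor_idem_mul (K := K) (Gamma.ofVertex T i) 1 1
  rw [one_mul] at hleft
  rw [mul_one] at hright
  rw [augmentationSection_apply, Finset.sum_eq_single i (fun j _ => hne j)
    fun h => absurd (Finset.mem_univ i) h]
  exact hleft.trans hright.symm

namespace IsDifferential

variable {d₀ : T.P K 0 →ₗ[T.Env K] T.Alg K} {d : ∀ n : ℕ, T.P K (n + 1) →ₗ[T.Env K] T.P K n}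

theorem augmentation_augmentationSection (hd : T.IsDifferential K d₀ d) (b : T.Alg K) :
    d₀ (T.augmentationSection K b) = b := by
  rw [augmentationSection_apply, map_sum]
  simp only [hd.augmentation_tensor, mul_one]
  rw [← Finset.mul_sum, sum_idem, mul_one]

theorem apply_pathDerivation (hd : T.IsDifferential K d₀ d) (p : QPath T.Q) :
    d 0 (pathDerivation K p) = T.augmentationSection K (T.ofPath K p) -
      T.tensor K 1 (Gamma.ofVertex T p.tgt) (T.ofPath K p) := by
  induction p using QPath.cons_induction with
  | triv i =>
    rw [pathDerivation_triv, map_zero]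
    exact (sub_eq_zero.2 (augmentationSection_idem i)).symm
  | cons a p h ih =>
    rw [pathDerivation_cons, map_add, map_smul, ih, hd.apply_ofArrow, ← arr_mul_ofPath,
      augmentationSection_mul, smul_sub, env_smul_tensor, one_mul, mul_one, mul_one, h]
    change _ = _ - T.tensor K 1 (Gamma.ofVertex T (T.Q.tgt a)) _
    abel

theorem homotopy_identity_zero (hd : T.IsDifferential K d₀ d) (x : T.P K 0) :
    d 0 (T.homotopy K 0 x) + T.augmentationSection K (d₀ x) = x := by
  refine eq_self_of_isNormal (g := (d 0).restrictScalars K ∘ₗ T.homotopy K 0 +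
    T.augmentationSection K ∘ₗ d₀.restrictScalars K) (fun a x => ?_) (fun γ u hu hsrc => ?_) x
  · simp only [LinearMap.add_apply, LinearMap.comp_apply, LinearMap.restrictScalars_apply,
      map_smul, homotopy_env_smul, smul_add]
    rw [T.env_smul K, mul_one, augmentationSection_mul]
  change d 0 (T.homotopy K 0 _) + T.augmentationSection K (d₀ _) = _
  obtain ⟨i, rfl⟩ : ∃ i, γ = Gamma.ofVertex T i := ⟨_, γ.eq_ofVertex⟩
  obtain rfl : i = u.tgt := hsrc
  rw [homotopy_zero_tensor hu _ rfl, map_neg, hd.apply_pathDerivation, hd.augmentation_tensor,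
    one_mul, idem_mul_ofPath, if_pos rfl]
  abel

theorem isGradedProjectiveResolution (hd : T.IsDifferential K d₀ d) :
    IsGradedProjectiveResolution.{w} (T.algGrading K) (T.algGrading K) (T.bimodGrading K) d₀ d where
  target_graded := isGradedBimod_algGrading K T
  gradedProjective n := isGradedProjective_bimodGrading K T n
  augmentation_degree := preservesGrading_of_generator (isGradedBimod_algGrading K T) d₀ fun γ => by
    rw [hd.augmentation]
    exact ofPath_mem_algGrading _
  differential_degree n :=
    preservesGrading_of_generator (isGradedBimod_bimodGrading K T n) (d n) fun γ => by
      rw [hd.apply_generator]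
      exact boundary_mem_bimodGrading γ
  surjective b := ⟨T.augmentationSection K b, hd.augmentation_augmentationSection b⟩
  exact_zero := exact_of_contraction (LinearMap.congr_fun hd.augmentation_comp)
    (T.homotopy K 0) (T.augmentationSection K) (map_zero _) hd.homotopy_identity_zero
  exact_succ n := exact_of_contraction (LinearMap.congr_fun (hd.comp n))
    (T.homotopy K (n + 1)) (T.homotopy K n) (map_zero _) hd.homotopy_identity

end IsDifferential

end Triple

end Exactness

end

end SkewGentle

theorem mainTheorem8 {K : Type uK} [Field K] {V : Type uV} {E : Type uE} [Fintype V] [Finite E]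
    (T : SkewGentle.Triple V E) :
    SkewGentle.IsGradedAlg (T.algGrading K) ∧
    (∃ (d₀ : T.P K 0 →ₗ[T.Env K] T.Alg K) (d : ∀ n : ℕ, T.P K (n + 1) →ₗ[T.Env K] T.P K n),
      T.IsDifferential K d₀ d) ∧
    ∀ (d₀ : T.P K 0 →ₗ[T.Env K] T.Alg K) (d : ∀ n : ℕ, T.P K (n + 1) →ₗ[T.Env K] T.P K n),
      T.IsDifferential K d₀ d →
      SkewGentle.IsGradedProjectiveResolution.{w} (T.algGrading K) (T.algGrading K) (T.bimodGrading K)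
        d₀ d :=
  ⟨SkewGentle.Triple.isGradedAlg_algGrading K T, SkewGentle.Triple.exists_isDifferential,
    fun _ _ hd => hd.isGradedProjectiveResolution⟩
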